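/- Work in the complex projective plane with affine coordinates $(x,y)$, and let $P_1=(0,1)$, $P_2=(0,-1)$. Consider the pairs $(B_2,B_2')$ of irreducible conics such that $B_2$ is tangent to the line $y=1$ at $P_1$ and to the line $y=-1$ at $P_2$, and such that $B_2$ and $B_2'$ meet at $P_1$ with intersection multiplicity $I(B_2,B_2';P_1)=3$ (hence transversely at one further point). Let $\Phi$ be the linear system of all conics $D$ with $I(B_2,D;P_2)\ge 3$. A smooth point $Q\in B_2'$ is called a conical flex point with respect to $\Phi$ if $I(B_2',D;Q)\ge \dim\Phi+1$ for some $D\in\Phi$. A plane sextic is of torus type if it has a defining equation of the form $F_2^3+F_3^2=0$ with nonzero homogeneous polynomials $F_2,F_3$ of degrees $2$ and $3$. Then for a generic such pair $(B_2,B_2')$ (that is, for all pairs in a non-empty, dense Zariski open subset of the family of these pairs) the following holds. The system $\Phi$ has dimension $2$. Besides the point $P_1$, which is a conical flex point because $B_2\in\Phi$, there are exactly five conical flex points $Q_1,\dots,Q_5$ on $B_2'$ with respect to $\Phi$. For each $i$ there is a unique conic $B_2''=B_2''(Q_i)\in\Phi$ with $I(B_2',B_2'';Q_i)\ge 3$;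 it is irreducible, and the singularities of the sextic $B_2+B_2'+B_2''$ are $[3A_5,3A_1]$, the three $A_5$ being at $P_1$, $P_2$ and $Q_i$. The sextic $B_2+B_2'+B_2''(Q_1)$ is of torus type, and the sextics $B_2+B_2'+B_2''(Q_i)$ for $i=2,3,4,5$ are not of torus type. -/

import Mathlib

/-! Plane curves over `ℂ`: forms in `x, y, z`, local intersection numbers, singularities of type
`A_n`, sextics of torus type, conical flex points, and generic pairs of conics. -/

noncomputable section

namespace ThreeConics

open MvPolynomial

/-- The complex projective plane. -/
abbrev Plane := Projectivization ℂ (Fin 3 → ℂ)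

/-- Polynomials in the homogeneous coordinates `x = X 0`, `y = X 1`, `z = X 2`. -/
abbrev Form := MvPolynomial (Fin 3) ℂ

/-- The ring of formal power series in two variables, the completed local ring of the plane at a
point. -/
abbrev Germ := MvPowerSeries (Fin 2) ℂ

/-- The homogeneous coordinates near the point `(v 0 : v 1 : v 2)` in terms of two affine
coordinates `X 0, X 1` centred at that point, in the first of the standard charts
`z = 1`, `y = 1`, `x = 1` that contains the point. -/
def localCoords (v : Fin 3 → ℂ) : Fin 3 → MvPolynomial (Fin 2) ℂ :=
  open Classical in
  if v 2 ≠ 0 then ![C (v 0 / v 2) + X 0, C (v 1 / v 2) + X 1, 1]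
  else if v 1 ≠ 0 then ![C (v 0 / v 1) + X 0, 1, C (v 2 / v 1) + X 1]
  else ![1, C (v 1 / v 0) + X 0, C (v 2 / v 0) + X 1]

/-- A local equation at `P` of the curve `F = 0`. -/
def germ (F : Form) (P : Plane) : Germ :=
  ((aeval (localCoords P.rep) F : MvPolynomial (Fin 2) ℂ) : MvPowerSeries (Fin 2) ℂ)

/-- The intersection number `I(F, G; P) = dim_ℂ 𝒪_P / (F, G)`, possibly infinite
(the length of a vector space over `ℂ` is its dimension). -/
def interMult (F G : Form) (P : Plane) : ℕ∞ :=
  Module.length ℂ (Germ ⧸ Ideal.span {germ F P, germ G P})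

/-- `P` is a singular point of the curve `F = 0`. -/
def IsSingularPoint (F : Form) (P : Plane) : Prop :=
  eval P.rep F = 0 ∧ ∀ i, eval P.rep (pderiv i F) = 0

/-- `P` is a smooth point of the curve `F = 0`. -/
def IsSmoothPoint (F : Form) (P : Plane) : Prop :=
  eval P.rep F = 0 ∧ ∃ i, eval P.rep (pderiv i F) ≠ 0

/-- `(u, v)` is a system of formal local coordinates of the plane at a point: both vanish there
and their differentials are linearly independent. -/
def IsLocalCoordinates (u v : Germ) : Prop :=
  MvPowerSeries.constantCoeff u = 0 ∧ MvPowerSeries.constantCoeff v = 0 ∧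
    MvPowerSeries.coeff (Finsupp.single 0 1) u * MvPowerSeries.coeff (Finsupp.single 1 1) v -
      MvPowerSeries.coeff (Finsupp.single 1 1) u * MvPowerSeries.coeff (Finsupp.single 0 1) v ≠ 0

/-- The curve `F = 0` has an `A_n` singularity at `P`: it is `v² = u^(n+1)` in suitable local
coordinates. -/
def IsTypeA (n : ℕ) (F : Form) (P : Plane) : Prop :=
  ∃ u v w : Germ, IsLocalCoordinates u v ∧ IsUnit w ∧ germ F P = w * (v ^ 2 - u ^ (n + 1))

/-- The singularities of `F = 0` are `[3A₅, 3A₁]`, the three `A₅` being the points of `S`. -/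
def HasSingularities3A5And3A1 (F : Form) (S : Set Plane) : Prop :=
  S.ncard = 3 ∧ (∀ P ∈ S, IsTypeA 5 F P) ∧
    ∃ T : Set Plane, T.ncard = 3 ∧ Disjoint S T ∧ (∀ P ∈ T, IsTypeA 1 F P) ∧
      {P | IsSingularPoint F P} = S ∪ T

/-- The sextic `F = 0` is of (2,3)-torus type. -/
def IsTorusType (F : Form) : Prop :=
  ∃ c : ℂ, c ≠ 0 ∧ ∃ F₂ F₃ : Form, F₂ ≠ 0 ∧ F₃ ≠ 0 ∧ F₂.IsHomogeneous 2 ∧ F₃.IsHomogeneous 3 ∧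
    C c * F = F₂ ^ 3 + F₃ ^ 2

/-- `F = 0` is an irreducible conic. -/
def IsConic (F : Form) : Prop := F.IsHomogeneous 2 ∧ Irreducible F

/-- `P` is a conical flex point of the curve `B = 0` with respect to the linear system of conics
`{h = 0}`, `0 ≠ h ∈ Φ`. The dimension of the linear system is `finrank Φ - 1`, so the condition
`I(B, h; P) ≥ dim + 1` reads `I(B, h; P) ≥ finrank Φ`. -/
def IsConicalFlex (Φ : Submodule ℂ Form) (B : Form) (P : Plane) : Prop :=
  IsSmoothPoint B P ∧ ∃ h ∈ Φ, h ≠ 0 ∧ (Module.finrank ℂ Φ : ℕ∞) ≤ interMult B h P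

/-- The point `(0, 1)` of the affine plane `z = 1`. -/
def P₁ : Plane := Projectivization.mk ℂ ![0, 1, 1] (fun h => by simpa using congrFun h 1)

/-- The point `(0, -1)` of the affine plane `z = 1`. -/
def P₂ : Plane := Projectivization.mk ℂ ![0, -1, 1] (fun h => by simpa using congrFun h 1)

/-- Two irreducible conics `f` and `g`: `f` touches the lines `y = 1` at `P₁` and `y = -1` at `P₂`,
and `f`, `g` meet at `P₁` with intersection number `3`. -/
structure IsConicPair (f g : Form) : Prop where
  conic_f : IsConic f
  conic_g : IsConic g
  tangent₁ : 2 ≤ interMult f (X 1 - X 2) P₁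
  tangent₂ : 2 ≤ interMult f (X 1 + X 2) P₂
  contact : interMult f g P₁ = 3

/-- The value of a polynomial `D` in the coefficients of two forms. -/
def evalCoeffs (D : MvPolynomial ((Fin 3 →₀ ℕ) ⊕ (Fin 3 →₀ ℕ)) ℂ) (f g : Form) : ℂ :=
  eval (Sum.elim (fun m => coeff m f) (fun m => coeff m g)) D

/-- `p` holds for a generic pair `(f, g)` of the family `W`: it holds on a non-empty Zariski open
subset `{D ≠ 0}` of `W` that is Zariski dense in `W`. -/
def HoldsGenerically (W p : Form → Form → Prop) : Prop :=
  ∃ D : MvPolynomial ((Fin 3 →₀ ℕ) ⊕ (Fin 3 →₀ ℕ)) ℂ,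
    (∃ f g, W f g ∧ evalCoeffs D f g ≠ 0) ∧
    (∀ E : MvPolynomial ((Fin 3 →₀ ℕ) ⊕ (Fin 3 →₀ ℕ)) ℂ,
      (∀ f g, W f g → evalCoeffs D f g ≠ 0 → evalCoeffs E f g = 0) →
        ∀ f g, W f g → evalCoeffs E f g = 0) ∧
    ∀ f g, W f g → evalCoeffs D f g ≠ 0 → p f g

end ThreeConics

end

/-! In coordinates `(u : v : w)` with `P₁ = (0 : 0 : 1)` and `P₂ = (0 : 1 : 0)` a pair of the family
becomes the pair of parabolas `w = u²`, `w = u² + u + δ`, and the conics of `Φ` become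
`A u² + B u w - A v w + K w² = 0`. Such a conic osculates the second parabola at the abscissa `r`
iff three linear equations in `A, B, K` hold. Their determinant vanishes iff
`(r + 2 δ) (3 r⁴ + 3 r³ + r² + δ r + δ²) = 0`, an equation with five simple roots for generic `δ`.

For `r = -2 δ` an explicit identity exhibits the sextic as a cube plus a square. Conversely, let a
sextic with the singularities `[3A₅, 3A₁]` be `F₂³ + F₃² = 0`. A common zero of `F₂` and the sextic
is a singular point and not a node, because the quadratic part of `F₂³ + F₃²` is the square of a
linear form; so it is an `A₅` point. Hence `F₂` restricts to each parabola as a polynomial with at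
most one zero whose cube is minus a square. For the roots `r ≠ -2 δ` this forces `F₂` to be
divisible by `v`, and then `F₂` vanishes at the points of the third conic on `v = 0`, which are
not of type `A₅`. -/

noncomputable section

namespace ThreeConics

open MvPolynomial

/-! ### Germs of plane curves -/

section LinearPart

variable {σ R : Type*} [CommRing R]

/-- The coefficient of the variable `X i` in a power series, that is, its partial derivative at the
origin in the direction `i`. -/
def linCoeff (i : σ) : MvPowerSeries σ R →ₗ[R] R := MvPowerSeries.coeff (Finsupp.single i 1)

lemma linCoeff_mul (i : σ) (a b : MvPowerSeries σ R) :
    linCoeff i (a * b) = linCoeff i a * b.constantCoeff + a.constantCoeff * linCoeff i b := by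
  classical
  rw [linCoeff, MvPowerSeries.coeff_mul, Finsupp.antidiagonal_single, Finset.sum_map,
    Finset.Nat.antidiagonal_succ]
  simp [add_comm]

lemma linCoeff_C (i : σ) (c : R) : linCoeff i (MvPowerSeries.C c) = 0 := by
  classical
  simp [linCoeff, MvPowerSeries.coeff_C]

lemma linCoeff_X [DecidableEq σ] (i j : σ) :
    linCoeff i (MvPowerSeries.X j : MvPowerSeries σ R) = if i = j then 1 else 0 := by
  classical
  simp [linCoeff, MvPowerSeries.coeff_X, Finsupp.single_left_inj]

lemma exists_eq_X_mul_add_X_mul {a : MvPowerSeries (Fin 2) R} (ha : a.constantCoeff = 0) :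
    ∃ p q : MvPowerSeries (Fin 2) R, a = MvPowerSeries.X 0 * p + MvPowerSeries.X 1 * q ∧
      p.constantCoeff = linCoeff 0 a ∧ q.constantCoeff = linCoeff 1 a := by
  let b : MvPowerSeries (Fin 2) R := fun m => if m 0 = 0 then MvPowerSeries.coeff m a else 0
  have coeff_b : ∀ m, MvPowerSeries.coeff m b = if m 0 = 0 then MvPowerSeries.coeff m a else 0 :=
    fun _ => rfl
  have dvd_b : MvPowerSeries.X 1 ∣ b := by
    rw [MvPowerSeries.X_dvd_iff]
    intro m hm
    rw [coeff_b]
    split_ifs with h0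
    · have hm0 : m = 0 := by
        ext i
        fin_cases i
        exacts [h0, hm]
      rw [hm0]
      exact ha
    · rfl
  have dvd_sub : MvPowerSeries.X 0 ∣ a - b := by
    rw [MvPowerSeries.X_dvd_iff]
    intro m hm
    rw [map_sub, coeff_b, if_pos hm, sub_self]
  obtain ⟨p, hp⟩ := dvd_sub
  obtain ⟨q, hq⟩ := dvd_b
  have h : a = MvPowerSeries.X 0 * p + MvPowerSeries.X 1 * q := by
    rw [← hp, ← hq, sub_add_cancel]
  refine ⟨p, q, h, ?_, ?_⟩ <;> rw [h] <;> simp [linCoeff_mul, linCoeff_X]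

lemma exists_eq_C_add_X_mul_add_X_mul (a : MvPowerSeries (Fin 2) R) :
    ∃ p q : MvPowerSeries (Fin 2) R,
      a = MvPowerSeries.C a.constantCoeff + MvPowerSeries.X 0 * p + MvPowerSeries.X 1 * q ∧
      p.constantCoeff = linCoeff 0 a ∧ q.constantCoeff = linCoeff 1 a := by
  obtain ⟨p, q, h, hp, hq⟩ :=
    exists_eq_X_mul_add_X_mul (a := a - MvPowerSeries.C a.constantCoeff) (by simp)
  rw [map_sub, linCoeff_C, sub_zero] at hp hq
  exact ⟨p, q, by rw [add_assoc, ← h]; ring, hp, hq⟩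

end LinearPart

lemma isUnit_mvPowerSeries_iff {σ K : Type*} [Field K] {a : MvPowerSeries σ K} :
    IsUnit a ↔ a.constantCoeff ≠ 0 :=
  MvPowerSeries.isUnit_iff_constantCoeff.trans isUnit_iff_ne_zero

lemma isUnit_powerSeries_iff {K : Type*} [Field K] {a : PowerSeries K} :
    IsUnit a ↔ a.constantCoeff ≠ 0 :=
  PowerSeries.isUnit_iff_constantCoeff.trans isUnit_iff_ne_zero

lemma isLocalCoordinates_iff {u v : Germ} :
    IsLocalCoordinates u v ↔ u.constantCoeff = 0 ∧ v.constantCoeff = 0 ∧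
      linCoeff 0 u * linCoeff 1 v - linCoeff 1 u * linCoeff 0 v ≠ 0 :=
  Iff.rfl

namespace IsLocalCoordinates

variable {u v : Germ}

lemma exists_eq_C_add (h : IsLocalCoordinates u v) (x : Germ) :
    ∃ e r : Germ, x = MvPowerSeries.C x.constantCoeff + u * e + v * r := by
  obtain ⟨hu, hv, hd⟩ := isLocalCoordinates_iff.1 h
  obtain ⟨p, q, hpq, hp, hq⟩ := exists_eq_X_mul_add_X_mul hu
  obtain ⟨p', q', hpq', hp', hq'⟩ := exists_eq_X_mul_add_X_mul hv
  obtain ⟨s, t, hst, -, -⟩ := exists_eq_C_add_X_mul_add_X_mul x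
  -- Cramer's rule: the matrix expressing `u, v` by the variables has unit determinant.
  have hunit : IsUnit (p * q' - q * p') := by
    rw [isUnit_mvPowerSeries_iff, map_sub, map_mul, map_mul, hp, hq, hp', hq']
    exact hd
  obtain ⟨w, hw⟩ := hunit.exists_left_inv
  refine ⟨w * (s * q' - t * p'), w * (t * p - s * q), ?_⟩
  linear_combination hst - (MvPowerSeries.X 0 * s + MvPowerSeries.X 1 * t) * hw
    - w * (s * q' - t * p') * hpq - w * (t * p - s * q) * hpq'

lemma symm (h : IsLocalCoordinates u v) : IsLocalCoordinates v u := by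
  obtain ⟨hu, hv, hd⟩ := isLocalCoordinates_iff.1 h
  refine isLocalCoordinates_iff.2 ⟨hv, hu, fun h0 => hd ?_⟩
  linear_combination -h0

lemma right_linear_comb (h : IsLocalCoordinates u v) {p : Germ} (hp : IsUnit p) (q : Germ) :
    IsLocalCoordinates v (u * p + v * q) := by
  obtain ⟨hu, hv, hd⟩ := isLocalCoordinates_iff.1 h
  refine isLocalCoordinates_iff.2 ⟨hv, by simp [hu, hv], ?_⟩
  have hjac : linCoeff 0 v * linCoeff 1 (u * p + v * q) -
      linCoeff 1 v * linCoeff 0 (u * p + v * q) =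
      -(p.constantCoeff * (linCoeff 0 u * linCoeff 1 v - linCoeff 1 u * linCoeff 0 v)) := by
    simp only [map_add, linCoeff_mul, hu, hv]
    ring
  rw [hjac]
  exact neg_ne_zero.2 (mul_ne_zero (isUnit_mvPowerSeries_iff.1 hp) hd)

end IsLocalCoordinates

/-- The germ `x` is `v² = u^(n+1)` in suitable local coordinates; `IsTypeA n F P` says this of the
local equation of `F` at `P`. -/
def IsGermOfTypeA (n : ℕ) (x : Germ) : Prop :=
  ∃ u v w : Germ, IsLocalCoordinates u v ∧ IsUnit w ∧ x = w * (v ^ 2 - u ^ (n + 1))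

lemma IsGermOfTypeA.mul_isUnit {n : ℕ} {x k : Germ} (hx : IsGermOfTypeA n x) (hk : IsUnit k) :
    IsGermOfTypeA n (x * k) := by
  obtain ⟨u, v, w, huv, hw, rfl⟩ := hx
  exact ⟨u, v, w * k, huv, hw.mul hk, by ring⟩

lemma IsLocalCoordinates.isGermOfTypeA {a c e r : Germ} (h : IsLocalCoordinates a c)
    (he : IsUnit e) (hr : IsUnit r) (n : ℕ) :
    IsGermOfTypeA (2 * n + 1) (a * (a * e + c ^ (n + 1) * r)) := by
  obtain ⟨e', he'⟩ := he.exists_left_inv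
  obtain ⟨r', hr'⟩ := hr.exists_left_inv
  have h2 : IsUnit (2 : Germ) :=
    (isUnit_iff_ne_zero.2 (two_ne_zero (α := ℂ))).map (algebraMap ℂ Germ)
  obtain ⟨half, hhalf⟩ := h2.exists_left_inv
  -- Complete the square in `a² e + a c^(n+1) r`.
  refine ⟨c, a * (2 * e * r') + c * c ^ n, half ^ 2 * e' * r ^ 2,
    h.right_linear_comb ((h2.mul he).mul (.of_mul_eq_one _ hr')) _,
    (((IsUnit.of_mul_eq_one _ hhalf).pow 2).mul (.of_mul_eq_one _ he')).mul (hr.pow 2), ?_⟩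
  have hquarter : half ^ 2 * 4 = 1 := by linear_combination (2 * half + 1) * hhalf
  calc a * (a * e + c ^ (n + 1) * r)
      = half ^ 2 * 4 * (e' * e) * (a ^ 2 * e * (r' * r) ^ 2 + a * c ^ (n + 1) * r * (r' * r)) := by
        rw [hquarter, he', hr']
        ring
    _ = _ := by ring

lemma IsLocalCoordinates.isGermOfTypeA_one {a b : Germ} (h : IsLocalCoordinates a b) :
    IsGermOfTypeA 1 (a * b) := by
  have hcoords : IsLocalCoordinates a (a - b) := by
    obtain ⟨ha, hb, hd⟩ := isLocalCoordinates_iff.1 h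
    refine isLocalCoordinates_iff.2 ⟨ha, by simp [ha, hb], ?_⟩
    rw [map_sub, map_sub]
    intro h0
    exact hd (by linear_combination -h0)
  simpa using hcoords.isGermOfTypeA isUnit_one isUnit_one.neg 0

/-! ### Smooth branches -/

/-- The homomorphism `ψ` to power series in one variable restricts germs to the smooth branch
`a = 0`, and `c` is a coordinate transversal to `a` that restricts to a uniformizer. -/
structure IsBranch (ψ : Germ →ₐ[ℂ] PowerSeries ℂ) (a c : Germ) : Prop where
  coords : IsLocalCoordinates a c
  map_eq_zero : ψ a = 0
  exists_unit : ∃ τ : PowerSeries ℂ, IsUnit τ ∧ ψ c = PowerSeries.X * τ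

namespace IsBranch

variable {ψ : Germ →ₐ[ℂ] PowerSeries ℂ} {a c : Germ}

lemma constantCoeff_map (h : IsBranch ψ a c) (x : Germ) :
    (ψ x).constantCoeff = x.constantCoeff := by
  obtain ⟨e, r, hx⟩ := h.coords.exists_eq_C_add x
  obtain ⟨τ, -, hτ⟩ := h.exists_unit
  have hC : ψ (MvPowerSeries.C x.constantCoeff) = PowerSeries.C x.constantCoeff := ψ.commutes _
  have hψ := congrArg ψ hx
  rw [map_add ψ, map_add ψ, map_mul ψ, map_mul ψ, h.map_eq_zero, hτ, hC] at hψ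
  simp [hψ]

lemma exists_eq_of_dvd (h : IsBranch ψ a c) {n : ℕ} {x : Germ} (hx : PowerSeries.X ^ n ∣ ψ x) :
    ∃ e r : Germ, x = a * e + c ^ n * r := by
  induction n with
  | zero => exact ⟨0, x, by simp⟩
  | succ n ih =>
    obtain ⟨e, r, her⟩ := ih ((pow_dvd_pow _ n.le_succ).trans hx)
    obtain ⟨τ, hτu, hτ⟩ := h.exists_unit
    have hr : PowerSeries.X ∣ ψ r := by
      have hψx : ψ x = PowerSeries.X ^ n * (τ ^ n * ψ r) := by
        rw [her, map_add, map_mul, map_mul, map_pow, h.map_eq_zero, hτ]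
        ring
      rw [hψx, pow_succ] at hx
      exact (hτu.pow n).dvd_mul_left.1
        ((mul_dvd_mul_iff_left (pow_ne_zero n PowerSeries.X_ne_zero)).1 hx)
    rw [PowerSeries.X_dvd_iff, h.constantCoeff_map] at hr
    obtain ⟨e', r', hr'⟩ := h.coords.exists_eq_C_add r
    rw [hr, map_zero, zero_add] at hr'
    exact ⟨e + c ^ n * e', r', by rw [her, hr']; ring⟩

lemma dvd_map_iff (h : IsBranch ψ a c) {n : ℕ} {x : Germ} :
    PowerSeries.X ^ n ∣ ψ x ↔ x ∈ Ideal.span {a, c ^ n} := by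
  rw [Ideal.mem_span_pair]
  constructor
  · intro hx
    obtain ⟨e, r, her⟩ := h.exists_eq_of_dvd hx
    exact ⟨e, r, by rw [her]; ring⟩
  · rintro ⟨e, r, rfl⟩
    obtain ⟨τ, -, hτ⟩ := h.exists_unit
    rw [map_add, map_mul, map_mul, map_pow, h.map_eq_zero, hτ]
    exact ⟨ψ r * τ ^ n, by ring⟩

lemma exists_pow_dvd_sub_map (h : IsBranch ψ a c) (n : ℕ) (y : PowerSeries ℂ) :
    ∃ x : Germ, PowerSeries.X ^ n ∣ y - ψ x := by
  induction n with
  | zero => exact ⟨0, by simp⟩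
  | succ n ih =>
    obtain ⟨x, z, hz⟩ := ih
    obtain ⟨τ, hτu, hτ⟩ := h.exists_unit
    have hτ0 := isUnit_powerSeries_iff.1 hτu
    set κ : ℂ := z.constantCoeff / τ.constantCoeff ^ n with hκ
    have hC : ψ (MvPowerSeries.C κ) = PowerSeries.C κ := ψ.commutes _
    have hsub : y - ψ (x + MvPowerSeries.C κ * c ^ n) =
        PowerSeries.X ^ n * (z - PowerSeries.C κ * τ ^ n) := by
      rw [map_add, map_mul, map_pow, hτ, hC]
      linear_combination hz
    refine ⟨x + MvPowerSeries.C κ * c ^ n, ?_⟩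
    rw [hsub, pow_succ]
    apply mul_dvd_mul_left
    rw [PowerSeries.X_dvd_iff]
    simp [hκ, hτ0]

lemma length_quotient_pow (h : IsBranch ψ a c) (n : ℕ) :
    Module.length ℂ (Germ ⧸ Ideal.span {a, c ^ n}) = n := by
  let jet : Germ →ₗ[ℂ] (Fin n → ℂ) :=
    LinearMap.pi fun i => (PowerSeries.coeff (R := ℂ) (i : ℕ)) ∘ₗ ψ.toLinearMap
  have jet_apply : ∀ x i, jet x i = PowerSeries.coeff (i : ℕ) (ψ x) := fun _ _ => rfl
  have ker_jet : LinearMap.ker jet = (Ideal.span {a, c ^ n}).restrictScalars ℂ := by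
    ext x
    rw [LinearMap.mem_ker, Submodule.restrictScalars_mem, ← h.dvd_map_iff,
      PowerSeries.X_pow_dvd_iff]
    exact ⟨fun hx m hm => congrFun hx ⟨m, hm⟩, fun hx => funext fun i => hx i i.2⟩
  have jet_surjective : Function.Surjective jet := by
    intro y
    obtain ⟨x, hx⟩ := h.exists_pow_dvd_sub_map n
      (PowerSeries.mk fun i => if hi : i < n then y ⟨i, hi⟩ else 0)
    refine ⟨x, funext fun i => ?_⟩
    have hi := PowerSeries.X_pow_dvd_iff.1 hx i i.2
    rw [map_sub, PowerSeries.coeff_mk, dif_pos i.2, sub_eq_zero] at hi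
    rw [jet_apply, ← hi]
  have equiv : (Germ ⧸ Ideal.span {a, c ^ n}) ≃ₗ[ℂ] (Fin n → ℂ) :=
    (Submodule.Quotient.restrictScalarsEquiv ℂ (Ideal.span {a, c ^ n})).symm.trans
      ((Submodule.quotEquivOfEq _ _ ker_jet.symm).trans
        (jet.quotKerEquivOfSurjective jet_surjective))
  rw [equiv.length_eq, Module.length_eq_finrank, Module.finrank_fin_fun]

lemma exists_eq_of_emultiplicity (h : IsBranch ψ a c) {n : ℕ} {b : Germ}
    (hb : emultiplicity PowerSeries.X (ψ b) = n) :
    ∃ e r : Germ, IsUnit r ∧ b = a * e + c ^ n * r := by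
  obtain ⟨hdvd, hndvd⟩ := emultiplicity_eq_coe.1 hb
  obtain ⟨e, r, her⟩ := h.exists_eq_of_dvd hdvd
  refine ⟨e, r, ?_, her⟩
  rw [isUnit_mvPowerSeries_iff]
  intro hr
  apply hndvd
  rw [← h.constantCoeff_map, ← PowerSeries.X_dvd_iff] at hr
  obtain ⟨τ, -, hτ⟩ := h.exists_unit
  obtain ⟨y, hy⟩ := hr
  rw [her, map_add, map_mul, map_mul, map_pow, h.map_eq_zero, hτ, hy]
  exact ⟨τ ^ n * y, by ring⟩

lemma length_quotient (h : IsBranch ψ a c) (b : Germ) :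
    Module.length ℂ (Germ ⧸ Ideal.span {a, b}) = emultiplicity PowerSeries.X (ψ b) := by
  apply le_antisymm
  · rcases eq_or_ne (emultiplicity PowerSeries.X (ψ b)) ⊤ with htop | hfin
    · rw [htop]
      exact le_top
    · obtain ⟨n, hn⟩ := ENat.ne_top_iff_exists.1 hfin
      obtain ⟨e, r, hr, rfl⟩ := h.exists_eq_of_emultiplicity hn.symm
      have hspan : Ideal.span {a, a * e + c ^ n * r} = Ideal.span {a, c ^ n} := by
        rw [add_comm, Ideal.span_pair_add_left_mul, Ideal.span_insert,
          Ideal.span_singleton_mul_right_unit hr, ← Ideal.span_insert]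
      rw [hspan, h.length_quotient_pow, hn]
  · rw [← ENat.forall_natCast_le_iff_le]
    intro n hn
    have hle : Ideal.span {a, b} ≤ Ideal.span {a, c ^ n} := by
      rw [Ideal.span_le]
      rintro x (rfl | rfl)
      · exact Ideal.subset_span (by simp)
      · exact h.dvd_map_iff.1 (pow_dvd_of_le_emultiplicity hn)
    rw [← h.length_quotient_pow n]
    exact Module.length_le_of_surjective
      ((Ideal.Quotient.factorₐ ℂ hle).toLinearMap) (Ideal.Quotient.factor_surjective hle)

lemma isGermOfTypeA (h : IsBranch ψ a c) {n : ℕ} {b : Germ} (hb0 : ∃ i, linCoeff i b ≠ 0)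
    (hb : emultiplicity PowerSeries.X (ψ b) = (n + 1 : ℕ)) : IsGermOfTypeA (2 * n + 1) (a * b) := by
  obtain ⟨e, r, hr, rfl⟩ := h.exists_eq_of_emultiplicity hb
  rcases eq_or_ne n 0 with rfl | hn
  · rw [zero_add, pow_one, add_comm (a * e)]
    exact (h.coords.symm.right_linear_comb hr e).isGermOfTypeA_one
  · obtain ⟨ha, hc, -⟩ := isLocalCoordinates_iff.1 h.coords
    refine h.coords.isGermOfTypeA (isUnit_mvPowerSeries_iff.2 fun he => ?_) hr n
    obtain ⟨i, hi⟩ := hb0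
    refine hi ?_
    simp [pow_succ, linCoeff_mul, ha, he, hc, hn]

end IsBranch

/-! ### Forms and linear changes of coordinates -/

section Homogeneous

variable {R A σ : Type*} [CommRing R] [CommRing A] [Algebra R A] {F : MvPolynomial σ R} {n : ℕ}

lemma aeval_mul_of_isHomogeneous (hF : F.IsHomogeneous n) (μ : A) (g : σ → A) :
    aeval (fun l => μ * g l) F = μ ^ n * aeval g F := by
  rw [aeval_def, aeval_def, eval₂_eq, eval₂_eq, Finset.mul_sum]
  refine Finset.sum_congr rfl fun d hd => ?_
  rw [hF.degree_eq_sum_deg_support hd]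
  simp only [mul_pow, Finset.prod_mul_distrib, Finset.prod_pow_eq_pow_sum]
  ring

lemma eval_smul_of_isHomogeneous (hF : F.IsHomogeneous n) (c : R) (v : σ → R) :
    eval (c • v) F = c ^ n * eval v F := by
  rw [← coe_aeval_eq_eval, ← coe_aeval_eq_eval]
  exact aeval_mul_of_isHomogeneous hF c v

lemma eval_smul_eq_zero_iff [IsDomain R] (hF : F.IsHomogeneous n) {c : R} (hc : c ≠ 0)
    (v : σ → R) : eval (c • v) F = 0 ↔ eval v F = 0 := by
  rw [eval_smul_of_isHomogeneous hF, mul_eq_zero, or_iff_right (pow_ne_zero n hc)]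

variable [Fintype σ]

lemma derivation_aeval (D : Derivation R A A) (g : σ → A) (F : MvPolynomial σ R) :
    D (aeval g F) = ∑ l, aeval g (pderiv l F) * D (g l) := by
  classical
  induction F using MvPolynomial.induction_on with
  | C a => simp
  | add p q hp hq => simp [hp, hq, add_mul, Finset.sum_add_distrib]
  | mul_X p i hp =>
    simp only [map_mul, aeval_X, Derivation.leibniz, smul_eq_mul, hp, pderiv_X, Pi.single_apply,
      map_add, add_mul, mul_ite, mul_one, mul_zero, apply_ite (aeval g), map_zero, ite_mul,
      zero_mul, Finset.sum_add_distrib, Finset.sum_ite_eq, Finset.mem_univ, if_true, Finset.mul_sum,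
      mul_assoc]

lemma euler_eval (hF : F.IsHomogeneous n) (v : σ → R) :
    ∑ l, v l * eval v (pderiv l F) = n * eval v F := by
  simpa using congrArg (eval v) hF.sum_X_mul_pderiv

end Homogeneous

/-- The curve `F = 0` has no singular point: the gradient of `F` has no non-trivial zero. -/
def IsSmooth (F : Form) : Prop := ∀ v : Fin 3 → ℂ, v ≠ 0 → ∃ i, eval v (pderiv i F) ≠ 0

/-- A system of homogeneous coordinates of the plane, encoded as the invertible matrix whose rows
are the coordinate functions. -/
abbrev Frame := (Matrix (Fin 3) (Fin 3) ℂ)ˣ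

section Frame

variable {V W : Type*} [AddCommGroup V] [Module ℂ V] [AddCommGroup W] [Module ℂ W] (M N : Frame)

/-- The coordinates in the frame `M` of a triple of vectors. Triples in a `ℂ`-vector space, rather
than in `ℂ` itself, are needed for parametrized curves. -/
def act : (Fin 3 → V) →ₗ[ℂ] (Fin 3 → V) :=
  LinearMap.pi fun i => ∑ j, M.1 i j • LinearMap.proj j

lemma act_apply (g : Fin 3 → V) (i : Fin 3) : act M g i = ∑ j, M.1 i j • g j := by
  simp [act]

lemma act_mul (g : Fin 3 → V) : act (M * N) g = act M (act N g) := by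
  ext i
  simp only [act_apply, Units.val_mul, Matrix.mul_apply, Finset.sum_smul, Finset.smul_sum,
    mul_smul]
  exact Finset.sum_comm

lemma act_one (g : Fin 3 → V) : act 1 g = g := by
  ext i
  simp [act_apply, Matrix.one_apply]

lemma act_act_inv (g : Fin 3 → V) : act M (act M⁻¹ g) = g := by
  rw [← act_mul, mul_inv_cancel, act_one]

lemma act_inv_act (g : Fin 3 → V) : act M⁻¹ (act M g) = g := by
  rw [← act_mul, inv_mul_cancel, act_one]

variable {M} in
lemma act_ne_zero {g : Fin 3 → V} (hg : g ≠ 0) : act M g ≠ 0 := by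
  intro h0
  apply hg
  rw [← act_inv_act M g, h0, map_zero]

lemma map_act (f : V →ₗ[ℂ] W) (g : Fin 3 → V) (i : Fin 3) :
    f (act M g i) = act M (fun j => f (g j)) i := by
  simp [act_apply]

/-- The substitution of the coordinates of the frame `M` into a form. -/
def pull : Form →ₐ[ℂ] Form := aeval (act M X)

lemma aeval_pull {A : Type*} [CommRing A] [Algebra ℂ A] (g : Fin 3 → A) (F : Form) :
    aeval g (pull M F) = aeval (act M g) F := by
  have h : (aeval g).comp (pull M) = aeval (act M g) := by
    ext l
    simp [pull, act_apply]
  exact DFunLike.congr_fun h F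

lemma eval_pull (v : Fin 3 → ℂ) (F : Form) : eval v (pull M F) = eval (act M v) F := by
  simpa only [aeval_eq_eval] using aeval_pull M v F

lemma pull_inv_pull (F : Form) : pull M⁻¹ (pull M F) = F := by
  rw [pull, aeval_pull, act_act_inv, aeval_X_left_apply]

lemma pull_one (F : Form) : pull 1 F = F := by
  rw [pull, act_one, aeval_X_left_apply]

lemma pull_injective : Function.Injective (pull M) :=
  Function.LeftInverse.injective (pull_inv_pull M)

lemma isHomogeneous_pull {F : Form} {n : ℕ} (hF : F.IsHomogeneous n) :
    (pull M F).IsHomogeneous n := by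
  rw [← one_mul n]
  refine hF.aeval _ fun i => ?_
  rw [act_apply]
  refine IsHomogeneous.sum _ _ _ fun j _ => ?_
  rw [smul_eq_C_mul]
  exact isHomogeneous_C_mul_X _ j

lemma eval_pderiv_pull (v : Fin 3 → ℂ) (F : Form) (i : Fin 3) :
    eval v (pderiv i (pull M F)) = ∑ l, eval (act M v) (pderiv l F) * M.1 l i := by
  have h : ∀ l, pderiv i (act M X l : Form) = C (M.1 l i) := fun l => by
    simp [act_apply, pderiv_X, Pi.single_apply, smul_eq_C_mul]
  rw [pull, derivation_aeval, map_sum]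
  refine Finset.sum_congr rfl fun l _ => ?_
  rw [map_mul, h, eval_C, ← pull, eval_pull]

variable {M} in
lemma exists_eval_pderiv_pull_ne_zero {v : Fin 3 → ℂ} {F : Form}
    (h : ∃ i, eval (act M v) (pderiv i F) ≠ 0) : ∃ i, eval v (pderiv i (pull M F)) ≠ 0 := by
  contrapose! h
  intro i
  rw [← pull_inv_pull M F, eval_pderiv_pull, act_inv_act]
  simp [h]

lemma IsSmooth.pull {F : Form} (hF : IsSmooth F) : IsSmooth (pull M F) :=
  fun _ hv => exists_eval_pderiv_pull_ne_zero (hF _ (act_ne_zero hv))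

end Frame

/-- The point `P` has the homogeneous coordinates `v` in the frame `M`. -/
def HasCoords (M : Frame) (P : Plane) (v : Fin 3 → ℂ) : Prop :=
  ∃ a : ℂ, a ≠ 0 ∧ act M P.rep = a • v

namespace HasCoords

variable {M : Frame} {P Q : Plane} {v w : Fin 3 → ℂ}

lemma of_act_eq_smul {a : ℂ} (h : act M P.rep = a • v) : HasCoords M P v := by
  refine ⟨a, ?_, h⟩
  rintro rfl
  exact act_ne_zero P.rep_nonzero (h.trans (zero_smul ℂ v))

lemma exists_act_inv_eq (h : HasCoords M P v) : ∃ a : ℂ, a ≠ 0 ∧ act M⁻¹ v = a • P.rep := by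
  obtain ⟨a, ha, hv⟩ := h
  refine ⟨a⁻¹, inv_ne_zero ha, ?_⟩
  rw [← act_inv_act M P.rep, hv, map_smul, smul_smul, inv_mul_cancel₀ ha, one_smul]

lemma eval_eq_zero_iff (h : HasCoords M P v) {F : Form} {n : ℕ} (hF : F.IsHomogeneous n) :
    eval P.rep (pull M F) = 0 ↔ eval v F = 0 := by
  obtain ⟨a, ha, hv⟩ := h
  rw [eval_pull, hv, eval_smul_eq_zero_iff hF ha]

lemma eq (hP : HasCoords M P v) (hQ : HasCoords M Q v) : P = Q := by
  obtain ⟨a, ha, hP⟩ := hP.exists_act_inv_eq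
  obtain ⟨b, -, hQ⟩ := hQ.exists_act_inv_eq
  rw [← P.mk_rep, ← Q.mk_rep, Projectivization.mk_eq_mk_iff']
  refine ⟨a⁻¹ * b, ?_⟩
  rw [mul_smul, ← hQ, hP, smul_smul, inv_mul_cancel₀ ha, one_smul]

lemma exists_eq_smul (hP : HasCoords M P v) (hQ : HasCoords M P w) : ∃ c : ℂ, v = c • w := by
  obtain ⟨a, ha, hP⟩ := hP
  obtain ⟨b, -, hQ⟩ := hQ
  exact ⟨a⁻¹ * b, by rw [mul_smul, ← hQ, hP, smul_smul, inv_mul_cancel₀ ha, one_smul]⟩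

end HasCoords

lemma hasCoords_mk {M : Frame} {v w : Fin 3 → ℂ} (hv : v ≠ 0) {b : ℂ} (h : act M v = b • w) :
    HasCoords M (Projectivization.mk ℂ v hv) w := by
  obtain ⟨a, ha⟩ := Projectivization.exists_smul_eq_mk_rep ℂ v hv
  refine .of_act_eq_smul (a := a * b) ?_
  rw [← ha, Units.smul_def, map_smul, h, mul_smul]

lemma exists_hasCoords (M : Frame) {v : Fin 3 → ℂ} (hv : v ≠ 0) : ∃ P, HasCoords M P v :=
  ⟨_, hasCoords_mk (v := act M⁻¹ v) (act_ne_zero hv) (b := 1) (by rw [act_act_inv, one_smul])⟩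

/-! ### Local equations -/

/-- The chart in which `localCoords` describes the plane near `v`: the coordinate `i` is set to `1`,
and the coordinates `j` and `k` are the affine ones. -/
structure IsChart (v : Fin 3 → ℂ) (i j k : Fin 3) : Prop where
  apply_ne_zero : v i ≠ 0
  ne : j ≠ k
  eq_of_ne : ∀ l, l ≠ j → l ≠ k → l = i
  localCoords_eq : ∀ l,
    localCoords v l = C (v l / v i) + if l = j then X 0 else if l = k then X 1 else 0

lemma exists_isChart {v : Fin 3 → ℂ} (hv : v ≠ 0) : ∃ i j k, IsChart v i j k := by
  by_cases h2 : v 2 ≠ 0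
  · refine ⟨2, 0, 1, h2, by decide, by decide, fun l => ?_⟩
    fin_cases l <;> simp [localCoords, h2]
  by_cases h1 : v 1 ≠ 0
  · refine ⟨1, 0, 2, h1, by decide, by decide, fun l => ?_⟩
    fin_cases l <;> simp [localCoords, h1, h2]
  have h0 : v 0 ≠ 0 := by
    intro h0
    push Not at h1 h2
    apply hv
    ext l
    fin_cases l <;> assumption
  refine ⟨0, 1, 2, h0, by decide, by decide, fun l => ?_⟩
  fin_cases l <;> simp [localCoords, h0, h1, h2]

section Coe

variable {σ R : Type*} [CommRing R] (p : MvPolynomial σ R)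

lemma constantCoeff_coe : (p : MvPowerSeries σ R).constantCoeff = eval 0 p := by
  rw [← MvPowerSeries.coeff_zero_eq_constantCoeff_apply, coeff_coe, eval_zero]
  rfl

lemma linCoeff_coe (i : σ) : linCoeff i (p : MvPowerSeries σ R) = eval 0 (pderiv i p) := by
  rw [linCoeff, coeff_coe, eval_zero, constantCoeff_eq, coeff_pderiv]
  simp

end Coe

lemma eval_aeval {σ τ R : Type*} [CommRing R] (v : τ → R) (g : σ → MvPolynomial τ R)
    (F : MvPolynomial σ R) : eval v (aeval g F) = eval (fun l => eval v (g l)) F := by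
  have h : (aeval v).comp (aeval g) = (aeval fun l => eval v (g l) : MvPolynomial σ R →ₐ[R] R) := by
    ext l
    simp [aeval_eq_eval]
  simpa [aeval_eq_eval] using DFunLike.congr_fun h F

lemma germ_mul (F G : Form) (P : Plane) : germ (F * G) P = germ F P * germ G P := by
  simp [germ]

namespace IsChart

variable {P : Plane} {i j k : Fin 3}

lemma eval_zero_aeval_localCoords (h : IsChart P.rep i j k) (F : Form) :
    eval 0 (aeval (localCoords P.rep) F) = eval ((P.rep i)⁻¹ • P.rep) F := by
  rw [eval_aeval]
  congr 2
  ext l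
  rw [h.localCoords_eq]
  split_ifs <;> simp [div_eq_inv_mul]

lemma constantCoeff_germ (h : IsChart P.rep i j k) (F : Form) :
    (germ F P).constantCoeff = eval ((P.rep i)⁻¹ • P.rep) F := by
  rw [germ, constantCoeff_coe, h.eval_zero_aeval_localCoords]

lemma linCoeff_zero_germ (h : IsChart P.rep i j k) (F : Form) :
    linCoeff 0 (germ F P) = eval ((P.rep i)⁻¹ • P.rep) (pderiv j F) := by
  have hl : ∀ l, pderiv 0 (localCoords P.rep l) = if l = j then 1 else 0 := fun l => by
    rw [h.localCoords_eq]
    split_ifs <;> simp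
  simp only [germ, linCoeff_coe, derivation_aeval, hl, mul_ite, mul_one, mul_zero,
    Finset.sum_ite_eq', Finset.mem_univ, if_true, h.eval_zero_aeval_localCoords]

lemma linCoeff_one_germ (h : IsChart P.rep i j k) (F : Form) :
    linCoeff 1 (germ F P) = eval ((P.rep i)⁻¹ • P.rep) (pderiv k F) := by
  have hl : ∀ l, pderiv 1 (localCoords P.rep l) = if l = k then 1 else 0 := fun l => by
    rw [h.localCoords_eq]
    split_ifs with hj hk
    · exact absurd (hj.symm.trans hk) h.ne
    all_goals simp
  simp only [germ, linCoeff_coe, derivation_aeval, hl, mul_ite, mul_one, mul_zero,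
    Finset.sum_ite_eq', Finset.mem_univ, if_true, h.eval_zero_aeval_localCoords]

end IsChart

section Germ

variable {F : Form} {n : ℕ} {P : Plane}

lemma constantCoeff_germ_eq_zero_iff (hF : F.IsHomogeneous n) (P : Plane) :
    (germ F P).constantCoeff = 0 ↔ eval P.rep F = 0 := by
  obtain ⟨i, j, k, h⟩ := exists_isChart P.rep_nonzero
  rw [h.constantCoeff_germ, eval_smul_eq_zero_iff hF (inv_ne_zero h.apply_ne_zero)]

lemma isUnit_germ (hF : F.IsHomogeneous n) (h : eval P.rep F ≠ 0) : IsUnit (germ F P) :=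
  isUnit_mvPowerSeries_iff.2 (mt (constantCoeff_germ_eq_zero_iff hF P).1 h)

lemma exists_linCoeff_germ_ne_zero (hF : F.IsHomogeneous n) (hP : IsSmoothPoint F P) :
    ∃ i, linCoeff i (germ F P) ≠ 0 := by
  obtain ⟨i, j, k, h⟩ := exists_isChart P.rep_nonzero
  obtain ⟨hP0, l, hl⟩ := hP
  by_contra! hc
  have hj := hc 0
  have hk := hc 1
  have hv := inv_ne_zero h.apply_ne_zero
  rw [h.linCoeff_zero_germ, eval_smul_eq_zero_iff hF.pderiv hv] at hj
  rw [h.linCoeff_one_germ, eval_smul_eq_zero_iff hF.pderiv hv] at hk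
  have hne : ∀ l, l ≠ i → eval P.rep (pderiv l F) = 0 := fun l hl => by
    by_cases hlj : l = j
    · exact hlj ▸ hj
    by_cases hlk : l = k
    · exact hlk ▸ hk
    exact absurd (h.eq_of_ne l hlj hlk) hl
  -- Euler's identity yields the vanishing of the remaining partial derivative.
  have euler := euler_eval hF P.rep
  rw [Fintype.sum_eq_single i fun l hl => by rw [hne l hl, mul_zero], hP0, mul_zero,
    mul_eq_zero, or_iff_right h.apply_ne_zero] at euler
  by_cases hli : l = i
  · exact hl (hli ▸ euler)
  · exact hl (hne l hli)

end Germ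

/-! ### Parametrized curves -/

section Restriction

variable {R : Type*} [CommRing R] {s : Fin 2 → PowerSeries R}
  (hs : ∀ i, (s i).constantCoeff = 0)

/-- The restriction of power series in two variables to the formal parametrized curve `s` through
the origin. -/
def restrict : MvPowerSeries (Fin 2) R →ₐ[R] PowerSeries R :=
  MvPowerSeries.substAlgHom (MvPowerSeries.hasSubst_of_constantCoeff_zero hs)

lemma restrict_X (i : Fin 2) : restrict hs (MvPowerSeries.X i) = s i :=
  MvPowerSeries.substAlgHom_X _ i

lemma restrict_C (c : R) : restrict hs (MvPowerSeries.C c) = PowerSeries.C c :=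
  (restrict hs).commutes c

lemma restrict_coe (p : MvPolynomial (Fin 2) R) :
    restrict hs (p : MvPowerSeries (Fin 2) R) = aeval s p :=
  MvPowerSeries.substAlgHom_coe _ p

lemma constantCoeff_restrict (x : MvPowerSeries (Fin 2) R) :
    (restrict hs x).constantCoeff = x.constantCoeff := by
  obtain ⟨p, q, hx, -, -⟩ := exists_eq_C_add_X_mul_add_X_mul x
  have h := congrArg (restrict hs) hx
  rw [map_add, map_add, map_mul, map_mul, restrict_X, restrict_X, restrict_C] at h
  simp [h, hs]

lemma coeff_one_restrict (x : MvPowerSeries (Fin 2) R) :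
    PowerSeries.coeff 1 (restrict hs x) =
      linCoeff 0 x * PowerSeries.coeff 1 (s 0) + linCoeff 1 x * PowerSeries.coeff 1 (s 1) := by
  obtain ⟨p, q, hx, hp, hq⟩ := exists_eq_C_add_X_mul_add_X_mul x
  have h := congrArg (restrict hs) hx
  rw [map_add, map_add, map_mul, map_mul, restrict_X, restrict_X, restrict_C] at h
  rw [h, ← hp, ← hq, ← constantCoeff_restrict hs p, ← constantCoeff_restrict hs q]
  simp [PowerSeries.coeff_mul, Finset.Nat.antidiagonal_succ, hs, mul_comm]

end Restriction

lemma exists_isBranch_restrict {s : Fin 2 → PowerSeries ℂ} (hs : ∀ i, (s i).constantCoeff = 0)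
    (hs1 : ∃ i, PowerSeries.coeff 1 (s i) ≠ 0) {a : Germ} (ha : restrict hs a = 0)
    (ha1 : ∃ i, linCoeff i a ≠ 0) : ∃ c, IsBranch (restrict hs) a c := by
  have ha0 : a.constantCoeff = 0 := by rw [← constantCoeff_restrict hs, ha, map_zero]
  have tangent := coeff_one_restrict hs a
  rw [ha, map_zero] at tangent
  obtain ⟨i, hi⟩ := hs1
  refine ⟨MvPowerSeries.X i, isLocalCoordinates_iff.2 ⟨ha0, by simp, fun h0 => ?_⟩, ha, ?_⟩
  · obtain ⟨l, hl⟩ := ha1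
    fin_cases i
    · have h1 : linCoeff 1 a = 0 := by simpa [linCoeff_X] using h0
      have h2 : linCoeff 0 a = 0 := (by simpa [h1] using tangent : _ ∨ _).resolve_right hi
      fin_cases l <;> contradiction
    · have h1 : linCoeff 0 a = 0 := by simpa [linCoeff_X] using h0
      have h2 : linCoeff 1 a = 0 := (by simpa [h1] using tangent : _ ∨ _).resolve_right hi
      fin_cases l <;> contradiction
  · obtain ⟨τ, hτ⟩ := PowerSeries.X_dvd_iff.2 (hs i)
    refine ⟨τ, isUnit_powerSeries_iff.2 ?_, by rw [restrict_X, hτ]⟩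
    rwa [hτ, PowerSeries.coeff_succ_X_mul, PowerSeries.coeff_zero_eq_constantCoeff_apply] at hi

lemma exists_eq_mul_aeval_localCoords {v : Fin 3 → ℂ} {Φ : Fin 3 → PowerSeries ℂ} {a : ℂ}
    (ha : a ≠ 0) (hv : v ≠ 0) (hΦ : (fun l => (Φ l).constantCoeff) = a • v)
    (himm : ∀ κ : ℂ, (fun l => PowerSeries.coeff 1 (Φ l)) ≠ κ • v) :
    ∃ (μ : PowerSeries ℂ) (s : Fin 2 → PowerSeries ℂ), IsUnit μ ∧
      (∀ i, (s i).constantCoeff = 0) ∧ (∃ i, PowerSeries.coeff 1 (s i) ≠ 0) ∧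
      ∀ l, Φ l = μ * aeval s (localCoords v l) := by
  obtain ⟨i, j, k, h⟩ := exists_isChart hv
  have hi := h.apply_ne_zero
  have hΦ0 : ∀ l, (Φ l).constantCoeff = a * v l := congrFun hΦ
  have hunit : IsUnit (Φ i) := isUnit_powerSeries_iff.2 (by rw [hΦ0]; exact mul_ne_zero ha hi)
  obtain ⟨ν, hν⟩ := hunit.exists_left_inv
  have hν0 : ν.constantCoeff * (a * v i) = 1 := by
    simpa [hΦ0] using congrArg PowerSeries.constantCoeff hν
  let d : Fin 3 → PowerSeries ℂ := fun l => ν * Φ l - PowerSeries.C (v l / v i)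
  have d_constantCoeff : ∀ l, (d l).constantCoeff = 0 := fun l => by
    simp only [d, map_sub, map_mul, hΦ0, PowerSeries.constantCoeff_C]
    field_simp
    linear_combination v l * hν0
  have di : d i = 0 := by simp [d, hν, hi]
  have hs (l) : aeval ![d j, d k] (localCoords v l) = PowerSeries.C (v l / v i) + d l := by
    rw [h.localCoords_eq, map_add, algHom_C]
    congr 1
    split_ifs with hj hk
    · simp [hj]
    · simp [hk]
    · rw [h.eq_of_ne l hj hk, di, map_zero]
  have hloc : ∀ l, Φ l = Φ i * aeval ![d j, d k] (localCoords v l) := fun l => by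
    rw [hs]
    linear_combination (-Φ l) * hν
  refine ⟨Φ i, ![d j, d k], hunit, by simp [Fin.forall_fin_two, d_constantCoeff], ?_, hloc⟩
  by_contra! hd
  have hd0 : ∀ l, PowerSeries.coeff 1 (d l) = 0 := fun l => by
    by_cases hj : l = j
    · exact hj ▸ hd 0
    by_cases hk : l = k
    · exact hk ▸ hd 1
    rw [h.eq_of_ne l hj hk, di, map_zero]
  refine himm (PowerSeries.coeff 1 (Φ i) / v i) (funext fun l => ?_)
  rw [hloc l, hs]
  simp [PowerSeries.coeff_mul, Finset.Nat.antidiagonal_succ, PowerSeries.coeff_C, hd0,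
    d_constantCoeff]
  ring

lemma exists_isBranch_germ {G : Form} {n : ℕ} (hG : G.IsHomogeneous n) {P : Plane}
    (hP : ∃ i, eval P.rep (pderiv i G) ≠ 0) {Φ : Fin 3 → PowerSeries ℂ} {a : ℂ} (ha : a ≠ 0)
    (hΦ : (fun l => (Φ l).constantCoeff) = a • P.rep)
    (himm : ∀ κ : ℂ, (fun l => PowerSeries.coeff 1 (Φ l)) ≠ κ • P.rep) (hGΦ : aeval Φ G = 0) :
    ∃ (ψ : Germ →ₐ[ℂ] PowerSeries ℂ) (c : Germ) (μ : PowerSeries ℂ), IsUnit μ ∧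
      (∀ (F : Form) (m : ℕ), F.IsHomogeneous m → aeval Φ F = μ ^ m * ψ (germ F P)) ∧
      IsBranch ψ (germ G P) c := by
  obtain ⟨μ, s, hμ, hs, hs1, hloc⟩ := exists_eq_mul_aeval_localCoords ha P.rep_nonzero hΦ himm
  have haeval : ∀ (F : Form) (m : ℕ), F.IsHomogeneous m →
      aeval Φ F = μ ^ m * restrict hs (germ F P) := fun F m hF => by
    have hcomp : aeval (fun l => aeval s (localCoords P.rep l)) =
        (aeval s).comp (aeval (localCoords P.rep)) := by
      ext l
      simp
    rw [germ, restrict_coe, ← AlgHom.comp_apply, ← hcomp, ← aeval_mul_of_isHomogeneous hF]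
    exact congrArg (fun g => aeval g F) (funext hloc)
  have hG0 : restrict hs (germ G P) = 0 :=
    (hμ.pow n).mul_right_eq_zero.1 ((haeval G n hG).symm.trans hGΦ)
  have hGP : IsSmoothPoint G P := by
    refine ⟨(constantCoeff_germ_eq_zero_iff hG P).1 ?_, hP⟩
    rw [← constantCoeff_restrict hs, hG0, map_zero]
  obtain ⟨c, hc⟩ := exists_isBranch_restrict hs hs1 hG0 (exists_linCoeff_germ_ne_zero hG hGP)
  exact ⟨restrict hs, c, μ, hμ, haeval, hc⟩

section Expansion

variable {R : Type*} [CommRing R] (t : R) (p : Polynomial R)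

/-- The power series expansion of a polynomial at `t`. -/
def expansion : Polynomial R →ₐ[R] PowerSeries R :=
  (Polynomial.coeToPowerSeries.algHom R).comp (Polynomial.taylorAlgHom t)

lemma expansion_apply : expansion t p = (Polynomial.taylor t p : Polynomial R) := by
  simp [expansion, Polynomial.coeToPowerSeries.algHom_apply]

lemma constantCoeff_expansion : (expansion t p).constantCoeff = p.eval t := by
  rw [expansion_apply, Polynomial.constantCoeff_coe, Polynomial.taylor_coeff_zero]

lemma coeff_one_expansion :
    PowerSeries.coeff 1 (expansion t p) = (Polynomial.derivative p).eval t := by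
  rw [expansion_apply, Polynomial.coeff_coe, Polynomial.taylor_coeff_one]

lemma emultiplicity_expansion :
    emultiplicity PowerSeries.X (expansion t p) =
      emultiplicity (Polynomial.X - Polynomial.C t) p := by
  rw [emultiplicity_eq_emultiplicity_iff]
  intro n
  rw [expansion_apply, PowerSeries.X_pow_dvd_iff, Polynomial.X_sub_C_pow_dvd_iff,
    Polynomial.X_pow_dvd_iff]
  simp [Polynomial.taylor_apply]

end Expansion

lemma emultiplicity_X_sub_C_pow_mul {R : Type*} [CommRing R] [IsDomain R] {t : R}
    {q : Polynomial R} (hq : q.eval t ≠ 0) (n : ℕ) :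
    emultiplicity (Polynomial.X - Polynomial.C t)
      ((Polynomial.X - Polynomial.C t) ^ n * q) = n := by
  rw [emultiplicity_mul (Polynomial.prime_X_sub_C t),
    emultiplicity_pow_self_of_prime (Polynomial.prime_X_sub_C t),
    emultiplicity_eq_zero.2 (by rwa [Polynomial.dvd_iff_isRoot]), add_zero]

/-- The point with parameter `t` of the curve parametrized by `φ`. -/
def arcEval (φ : Fin 3 → Polynomial ℂ) (t : ℂ) : Fin 3 → ℂ := fun l => (φ l).eval t

lemma polynomial_eval_aeval (φ : Fin 3 → Polynomial ℂ) (t : ℂ) (F : Form) :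
    (aeval φ F).eval t = eval (arcEval φ t) F := by
  have h : (Polynomial.aeval t).comp (aeval φ) = aeval (arcEval φ t) := by
    ext l
    simp [arcEval]
  simpa [aeval_eq_eval] using DFunLike.congr_fun h F

/-- The curve parametrized by `φ` lies on the curve `G = 0` and is immersed at the parameter `t`. -/
structure IsArc (φ : Fin 3 → Polynomial ℂ) (t : ℂ) (G : Form) : Prop where
  immersive : ∀ κ : ℂ, (fun l => (Polynomial.derivative (φ l)).eval t) ≠ κ • arcEval φ t
  aeval_eq_zero : aeval φ G = 0

namespace IsArc

variable {φ : Fin 3 → Polynomial ℂ} {t : ℂ} {F G : Form} {M : Frame} {P : Plane} {m n : ℕ}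

lemma exists_isBranch (h : IsArc φ t G) (hG : G.IsHomogeneous n) (hGs : IsSmooth G)
    (hP : HasCoords M P (arcEval φ t)) :
    ∃ (ψ : Germ →ₐ[ℂ] PowerSeries ℂ) (c : Germ), IsBranch ψ (germ (pull M G) P) c ∧
      ∀ (F : Form) (m : ℕ), F.IsHomogeneous m →
        emultiplicity PowerSeries.X (ψ (germ (pull M F) P)) =
          emultiplicity (Polynomial.X - Polynomial.C t) (aeval φ F) := by
  obtain ⟨a, ha, haP⟩ := hP.exists_act_inv_eq
  let Φ := act M⁻¹ fun l => expansion t (φ l)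
  have hΦ : ∀ F, aeval Φ (pull M F) = expansion t (aeval φ F) := fun F => by
    have hcomp : aeval (fun l => expansion t (φ l)) = (expansion t).comp (aeval φ) := by
      ext l
      simp
    rw [aeval_pull, act_act_inv, hcomp, AlgHom.comp_apply]
  have hΦ0 : (fun l => (Φ l).constantCoeff) = a • P.rep := by
    rw [← haP]
    ext l
    rw [← PowerSeries.coeff_zero_eq_constantCoeff_apply, map_act]
    simp only [PowerSeries.coeff_zero_eq_constantCoeff_apply, constantCoeff_expansion]
    rfl
  have himm : ∀ κ : ℂ, (fun l => PowerSeries.coeff 1 (Φ l)) ≠ κ • P.rep := fun κ hκ => by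
    refine h.immersive (κ * a⁻¹) ?_
    have hΦ1 : (fun l => PowerSeries.coeff 1 (Φ l)) =
        act M⁻¹ fun l => (Polynomial.derivative (φ l)).eval t := by
      ext l
      rw [map_act]
      simp only [coeff_one_expansion]
    rw [← act_act_inv M fun l => (Polynomial.derivative (φ l)).eval t, ← hΦ1, hκ, mul_smul,
      ← act_act_inv M (arcEval φ t), haP, ← map_smul, ← map_smul, smul_smul a⁻¹,
      inv_mul_cancel₀ ha, one_smul]
  obtain ⟨ψ, c, μ, hμ, hψ, hc⟩ := exists_isBranch_germ (isHomogeneous_pull M hG)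
    (hGs.pull M P.rep P.rep_nonzero) ha hΦ0 himm (by rw [hΦ, h.aeval_eq_zero, map_zero])
  refine ⟨ψ, c, hc, fun F m hF => ?_⟩
  rw [← emultiplicity_expansion, ← hΦ, hψ _ m (isHomogeneous_pull M hF),
    emultiplicity_mul PowerSeries.X_prime,
    emultiplicity_of_isUnit_right PowerSeries.X_prime.not_isUnit (hμ.pow m), zero_add]

lemma interMult_pull (h : IsArc φ t G) (hG : G.IsHomogeneous n) (hGs : IsSmooth G)
    (hP : HasCoords M P (arcEval φ t)) (hF : F.IsHomogeneous m) :
    interMult (pull M G) (pull M F) P =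
      emultiplicity (Polynomial.X - Polynomial.C t) (aeval φ F) := by
  obtain ⟨ψ, c, hc, hψ⟩ := h.exists_isBranch hG hGs hP
  rw [interMult, hc.length_quotient, hψ F m hF]

lemma le_interMult_pull_iff (h : IsArc φ t G) (hG : G.IsHomogeneous n) (hGs : IsSmooth G)
    (hP : HasCoords M P (arcEval φ t)) (hF : F.IsHomogeneous m) (k : ℕ) :
    k ≤ interMult (pull M G) (pull M F) P ↔
      (Polynomial.X - Polynomial.C t) ^ k ∣ aeval φ F := by
  rw [h.interMult_pull hG hGs hP hF, pow_dvd_iff_le_emultiplicity]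

lemma isTypeA_pull_mul (h : IsArc φ t G) (hG : G.IsHomogeneous n) (hGs : IsSmooth G)
    (hP : HasCoords M P (arcEval φ t)) (hF : F.IsHomogeneous m) (hFs : IsSmooth F) {k : ℕ}
    {q : Polynomial ℂ} (hq : q.eval t ≠ 0)
    (hFq : aeval φ F = (Polynomial.X - Polynomial.C t) ^ (k + 1) * q)
    {K : Form} {l : ℕ} (hK : K.IsHomogeneous l) (hPK : eval P.rep K ≠ 0) :
    IsTypeA (2 * k + 1) (pull M G * pull M F * K) P := by
  obtain ⟨ψ, c, hc, hψ⟩ := h.exists_isBranch hG hGs hP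
  have hFP : IsSmoothPoint (pull M F) P := by
    refine ⟨?_, hFs.pull M P.rep P.rep_nonzero⟩
    rw [hP.eval_eq_zero_iff hF, ← polynomial_eval_aeval, hFq]
    simp
  have htype := (hc.isGermOfTypeA (exists_linCoeff_germ_ne_zero (isHomogeneous_pull M hF) hFP)
    ((hψ F m hF).trans (by rw [hFq, emultiplicity_X_sub_C_pow_mul hq]))).mul_isUnit
      (isUnit_germ hK hPK)
  rwa [← germ_mul, ← germ_mul] at htype

end IsArc

/-! ### Conics -/

section LowDegree

variable {R σ : Type*} [CommRing R] [Fintype σ]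

lemma exists_eq_sum_of_isHomogeneous_one {F : MvPolynomial σ R} (hF : F.IsHomogeneous 1) :
    ∃ a : σ → R, F = ∑ i, C (a i) * X i := by
  have hconst (i : σ) : ∃ a, pderiv i F = C a :=
    ⟨_, totalDegree_eq_zero_iff_eq_C.1 <|
      (totalDegree_zero_iff_isHomogeneous _).2 (hF.pderiv (i := i))⟩
  choose a ha using hconst
  refine ⟨a, ?_⟩
  rw [← one_smul ℕ F, ← hF.sum_X_mul_pderiv]
  exact Finset.sum_congr rfl fun i _ => by rw [ha, mul_comm]

lemma exists_eq_C_add_sum_of_totalDegree_le_one {F : MvPolynomial σ R} (hF : F.totalDegree ≤ 1) :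
    ∃ (k : R) (a : σ → R), F = C k + ∑ i, C (a i) * X i := by
  obtain ⟨a, ha⟩ := exists_eq_sum_of_isHomogeneous_one (homogeneousComponent_isHomogeneous 1 F)
  refine ⟨coeff 0 F, a, ?_⟩
  rw [← homogeneousComponent_zero, ← ha]
  have hsum : ∑ i ∈ Finset.range (F.totalDegree + 1), homogeneousComponent i F =
      ∑ i ∈ Finset.range 2, homogeneousComponent i F := by
    refine Finset.sum_subset (Finset.range_subset_range.2 (by lia)) fun i _ hi => ?_
    exact homogeneousComponent_eq_zero _ _ (by simpa using hi)
  rw [sum_homogeneousComponent] at hsum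
  simpa [Finset.sum_range_succ] using hsum

lemma eval_pderiv_C_add_sum (k : R) (a v : σ → R) (i : σ) :
    eval v (pderiv i (C k + ∑ j, C (a j) * X j : MvPolynomial σ R)) = a i := by
  classical
  simp [pderiv_X, Pi.single_apply]

end LowDegree

lemma exists_common_zero (a b : Fin 3 → ℂ) :
    ∃ v : Fin 3 → ℂ, v ≠ 0 ∧ ∑ i, a i * v i = 0 ∧ ∑ i, b i * v i = 0 := by
  let L : (Fin 3 → ℂ) →ₗ[ℂ] (Fin 2 → ℂ) := Matrix.toLin' ![a, b]
  obtain ⟨v, hv, hv0⟩ := (Submodule.ne_bot_iff _).1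
    (LinearMap.ker_ne_bot_of_finrank_lt (f := L) (by simp))
  exact ⟨v, hv0, congrFun hv 0, congrFun hv 1⟩

/-- The partial derivatives of `G * H` are linear forms, hence vanish at `0`. They take the same
value at a common zero `v` of the linear parts of `G` and `H`. -/
lemma not_isSmooth_mul {G H : Form} (hG : G.totalDegree ≤ 1) (hH : H.totalDegree ≤ 1)
    (hGH : (G * H).IsHomogeneous 2) : ¬ IsSmooth (G * H) := by
  obtain ⟨k, a, rfl⟩ := exists_eq_C_add_sum_of_totalDegree_le_one hG
  obtain ⟨l, b, rfl⟩ := exists_eq_C_add_sum_of_totalDegree_le_one hH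
  obtain ⟨v, hv, hav, hbv⟩ := exists_common_zero a b
  intro hs
  obtain ⟨i, hi⟩ := hs v hv
  have h0 := eval_smul_of_isHomogeneous (hGH.pderiv (i := i)) 0 v
  simp only [Derivation.leibniz, smul_eq_mul, map_add (eval _), map_mul, eval_pderiv_C_add_sum,
    eval_C, map_sum, eval_X, hav, hbv, zero_smul, Pi.zero_apply, mul_zero,
    Finset.sum_const_zero] at hi h0
  exact hi (by simpa using h0)

lemma IsSmooth.ne_zero {F : Form} (hF : IsSmooth F) : F ≠ 0 := by
  rintro rfl
  obtain ⟨i, hi⟩ := hF 1 one_ne_zero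
  simp at hi

lemma IsSmooth.isConic {F : Form} (hF : IsSmooth F) (hF2 : F.IsHomogeneous 2) : IsConic F := by
  have hdeg := hF2.totalDegree hF.ne_zero
  have totalDegree_ne_zero {G : Form} (hG0 : G ≠ 0) (hG : ¬ IsUnit G) : G.totalDegree ≠ 0 := by
    contrapose! hG
    rw [totalDegree_eq_zero_iff_eq_C] at hG
    rw [hG] at hG0 ⊢
    exact (isUnit_iff_ne_zero.2 (by simpa using hG0)).map C
  refine ⟨hF2, fun hu => ?_, fun G H hGH => ?_⟩
  · obtain ⟨c, -, rfl⟩ := MvPolynomial.isUnit_iff_eq_C_of_isReduced.1 hu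
    simp at hdeg
  · by_contra! hu
    subst hGH
    have hG0 := left_ne_zero_of_mul hF.ne_zero
    have hH0 := right_ne_zero_of_mul hF.ne_zero
    have hG := totalDegree_ne_zero hG0 hu.1
    have hH := totalDegree_ne_zero hH0 hu.2
    rw [totalDegree_mul_of_isDomain hG0 hH0] at hdeg
    exact not_isSmooth_mul (by lia) (by lia) hF2 hF

/-- The quadratic form with the coefficients `a` of `x²`, `b` of `xy`, `c` of `xz`, `d` of `y²`,
`e` of `yz` and `k` of `z²`. -/
def quad {R : Type*} [CommRing R] (a b c d e k : R) : MvPolynomial (Fin 3) R :=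
  C a * X 0 ^ 2 + C b * (X 0 * X 1) + C c * (X 0 * X 2) + C d * X 1 ^ 2 + C e * (X 1 * X 2) +
    C k * X 2 ^ 2

section quad

variable (a b c d e k : ℂ)

lemma isHomogeneous_quad : (quad a b c d e k).IsHomogeneous 2 := by
  have hX2 (i : Fin 3) : (X i ^ 2 : Form).IsHomogeneous 2 := isHomogeneous_X_pow i 2
  have hXX (i j : Fin 3) : (X i * X j : Form).IsHomogeneous 2 :=
    (isHomogeneous_X ℂ i).mul (isHomogeneous_X ℂ j)
  exact ((((((hX2 0).C_mul a).add ((hXX 0 1).C_mul b)).add ((hXX 0 2).C_mul c)).add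
    ((hX2 1).C_mul d)).add ((hXX 1 2).C_mul e)).add ((hX2 2).C_mul k)

lemma aeval_quad {A : Type*} [CommRing A] [Algebra ℂ A] (g : Fin 3 → A) :
    aeval g (quad a b c d e k) = algebraMap ℂ A a * g 0 ^ 2 + algebraMap ℂ A b * (g 0 * g 1) +
      algebraMap ℂ A c * (g 0 * g 2) + algebraMap ℂ A d * g 1 ^ 2 +
      algebraMap ℂ A e * (g 1 * g 2) + algebraMap ℂ A k * g 2 ^ 2 := by
  simp [quad]

lemma eval_quad (v : Fin 3 → ℂ) :
    eval v (quad a b c d e k) = a * v 0 ^ 2 + b * (v 0 * v 1) + c * (v 0 * v 2) + d * v 1 ^ 2 +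
      e * (v 1 * v 2) + k * v 2 ^ 2 := by
  simp [quad]

lemma eval_pderiv_quad (v : Fin 3 → ℂ) (i : Fin 3) :
    eval v (pderiv i (quad a b c d e k)) =
      (!![2 * a, b, c; b, 2 * d, e; c, e, 2 * k].mulVec v) i := by
  fin_cases i <;> simp [quad, pderiv_X, Matrix.mulVec, dotProduct, Fin.sum_univ_three] <;>
    ring

variable {a b c d e k} in
lemma isSmooth_quad (h : !![2 * a, b, c; b, 2 * d, e; c, e, 2 * k].det ≠ 0) :
    IsSmooth (quad a b c d e k) := by
  intro v hv
  contrapose! hv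
  exact Matrix.eq_zero_of_mulVec_eq_zero h (funext fun i => by rw [← eval_pderiv_quad, hv]; rfl)

end quad

lemma exists_eq_quad {F : Form} (hF : F.IsHomogeneous 2) :
    ∃ a b c d e k : ℂ, F = quad a b c d e k := by
  choose a ha using fun i => exists_eq_sum_of_isHomogeneous_one (hF.pderiv (i := i))
  refine ⟨a 0 0 / 2, (a 0 1 + a 1 0) / 2, (a 0 2 + a 2 0) / 2, a 1 1 / 2, (a 1 2 + a 2 1) / 2,
    a 2 2 / 2, MvPolynomial.funext fun v => ?_⟩
  have heuler := euler_eval hF v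
  simp only [ha, Fin.sum_univ_three, map_add, map_mul, eval_C, eval_X] at heuler
  rw [eval_quad]
  push_cast at heuler
  linear_combination -heuler / 2

/-! ### Unions of three curves -/

section Union

variable {F G H : Form}

lemma isSingularPoint_mul_iff {P : Plane} (hF : IsSmooth F) (hG : IsSmooth G) (hH : IsSmooth H) :
    IsSingularPoint (F * G * H) P ↔ (eval P.rep F = 0 ∧ eval P.rep G = 0) ∨
      (eval P.rep F = 0 ∧ eval P.rep H = 0) ∨ (eval P.rep G = 0 ∧ eval P.rep H = 0) := by
  have hd (i : Fin 3) : eval P.rep (pderiv i (F * G * H)) =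
      eval P.rep F * eval P.rep G * eval P.rep (pderiv i H) + eval P.rep H *
        (eval P.rep F * eval P.rep (pderiv i G) + eval P.rep G * eval P.rep (pderiv i F)) := by
    simp only [Derivation.leibniz, smul_eq_mul, map_add, map_mul]
  obtain ⟨i, hi⟩ := hF _ P.rep_nonzero
  obtain ⟨j, hj⟩ := hG _ P.rep_nonzero
  obtain ⟨k, hk⟩ := hH _ P.rep_nonzero
  simp only [IsSingularPoint, hd, map_mul]
  constructor
  · rintro ⟨h0, h1⟩
    have hi' := h1 i
    have hj' := h1 j
    have hk' := h1 k
    grind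
  · rintro (⟨h1, h2⟩ | ⟨h1, h2⟩ | ⟨h1, h2⟩) <;> simp [h1, h2]

/-- The curves `F` and `G` meet exactly in a point `p` with contact of order three and in a point
`q` transversely. The contact is recorded by the singularities it produces on the union of `F`, `G`
and any further curve that avoids the point. -/
structure IsContactPair (F G : Form) (p q : Plane) : Prop where
  ne : p ≠ q
  mem_iff : ∀ P : Plane, eval P.rep F = 0 ∧ eval P.rep G = 0 ↔ P = p ∨ P = q
  isTypeA_five : ∀ {K : Form} {k : ℕ}, K.IsHomogeneous k → eval p.rep K ≠ 0 →
    IsTypeA 5 (F * G * K) p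
  isTypeA_one : ∀ {K : Form} {k : ℕ}, K.IsHomogeneous k → eval q.rep K ≠ 0 →
    IsTypeA 1 (F * G * K) q

theorem hasSingularities3A5And3A1_mul (hF : IsSmooth F) (hG : IsSmooth G) (hH : IsSmooth H)
    {m n k : ℕ} (hFm : F.IsHomogeneous m) (hGn : G.IsHomogeneous n) (hHk : H.IsHomogeneous k)
    {p₁ p₂ p₃ q₁ q₂ q₃ : Plane} (hFG : IsContactPair F G p₁ q₁) (hFH : IsContactPair F H p₂ q₂)
    (hGH : IsContactPair G H p₃ q₃)
    (hFGH : ∀ P : Plane, eval P.rep F = 0 → eval P.rep G = 0 → eval P.rep H ≠ 0) :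
    HasSingularities3A5And3A1 (F * G * H) {p₁, p₂, p₃} := by
  have hp₁ := (hFG.mem_iff p₁).2 (Or.inl rfl)
  have hq₁ := (hFG.mem_iff q₁).2 (Or.inr rfl)
  have hp₂ := (hFH.mem_iff p₂).2 (Or.inl rfl)
  have hq₂ := (hFH.mem_iff q₂).2 (Or.inr rfl)
  have hp₃ := (hGH.mem_iff p₃).2 (Or.inl rfl)
  have hq₃ := (hGH.mem_iff q₃).2 (Or.inr rfl)
  have hFHG : F * G * H = F * H * G := mul_right_comm F G H
  have hGHF : F * G * H = G * H * F := by ring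
  refine ⟨Set.ncard_eq_three.2 ⟨p₁, p₂, p₃, ?_, ?_, ?_, rfl⟩, ?_, {q₁, q₂, q₃},
    Set.ncard_eq_three.2 ⟨q₁, q₂, q₃, ?_, ?_, ?_, rfl⟩, ?_, ?_, ?_⟩
  case refine_4 =>
    rintro P (rfl | rfl | rfl)
    · exact hFG.isTypeA_five hHk (by grind)
    · exact hFHG ▸ hFH.isTypeA_five hGn (by grind)
    · exact hGHF ▸ hGH.isTypeA_five hFm (by grind)
  case refine_8 =>
    simp only [Set.disjoint_insert_left, Set.disjoint_singleton_left, Set.mem_insert_iff,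
      Set.mem_singleton_iff]
    grind [hFG.ne, hFH.ne, hGH.ne]
  case refine_9 =>
    rintro P (rfl | rfl | rfl)
    · exact hFG.isTypeA_one hHk (by grind)
    · exact hFHG ▸ hFH.isTypeA_one hGn (by grind)
    · exact hGHF ▸ hGH.isTypeA_one hFm (by grind)
  case refine_10 =>
    ext P
    simp only [Set.mem_ofPred_eq, isSingularPoint_mul_iff hF hG hH, hFG.mem_iff,
      hFH.mem_iff, hGH.mem_iff, Set.mem_union, Set.mem_insert_iff, Set.mem_singleton_iff]
    tauto
  all_goals grind

end Union

/-! ### Three conics in normal form -/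

/-- The projective closure of the parabola `w = u² + ε u + δ` in the chart `(u : 1 : w)`. The
factor `c ≠ 0` makes room for all equations of the same conic. -/
def parabola (c ε δ : ℂ) : Form := quad c (c * ε) 0 (c * δ) (-c) 0

/-- The conics meeting the parabola `w = u²` in `(0 : 1 : 0)` with contact of order three. They
form the linear system of the theorem in normal form. -/
def contactConic (A B K : ℂ) : Form := quad A 0 B 0 (-A) K

/-- The point with abscissa `t` of the parabola `w = u² + ε u + δ`. -/
def parabolaPoint (ε δ t : ℂ) : Fin 3 → ℂ := ![t, 1, t ^ 2 + ε * t + δ]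

/-- The parabola `w = u² + ε u + δ`, parametrized by the abscissa. -/
def parabolaArc (ε δ : ℂ) : Fin 3 → Polynomial ℂ :=
  ![Polynomial.X, 1, Polynomial.X ^ 2 + Polynomial.C ε * Polynomial.X + Polynomial.C δ]

/-- The parabola `w = u² + ε u + δ`, parametrized by the inverse of the abscissa. It passes through
the point at infinity `(0 : 0 : 1)` for the parameter `0`. -/
def parabolaArcInfty (ε δ : ℂ) : Fin 3 → Polynomial ℂ :=
  ![Polynomial.X, Polynomial.X ^ 2,
    1 + Polynomial.C ε * Polynomial.X + Polynomial.C δ * Polynomial.X ^ 2]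

section Parabola

variable {c ε δ A : ℂ} (B K : ℂ)

lemma isHomogeneous_parabola : (parabola c ε δ).IsHomogeneous 2 := isHomogeneous_quad ..

lemma isHomogeneous_contactConic : (contactConic A B K).IsHomogeneous 2 := isHomogeneous_quad ..

lemma isSmooth_parabola (hc : c ≠ 0) : IsSmooth (parabola c ε δ) :=
  isSmooth_quad (by simp [Matrix.det_fin_three, hc])

lemma isSmooth_contactConic (hA : A ≠ 0) : IsSmooth (contactConic A B K) :=
  isSmooth_quad (by simp [Matrix.det_fin_three, hA])

variable (c ε δ A)

lemma eval_parabola (v : Fin 3 → ℂ) :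
    eval v (parabola c ε δ) = c * (v 0 ^ 2 + ε * v 0 * v 1 + δ * v 1 ^ 2 - v 1 * v 2) := by
  rw [parabola, eval_quad]
  ring

lemma eval_contactConic (v : Fin 3 → ℂ) :
    eval v (contactConic A B K) = A * (v 0 ^ 2 - v 1 * v 2) + B * (v 0 * v 2) + K * v 2 ^ 2 := by
  rw [contactConic, eval_quad]
  ring

lemma arcEval_parabolaArc (t : ℂ) : arcEval (parabolaArc ε δ) t = parabolaPoint ε δ t := by
  ext i
  fin_cases i <;> simp [arcEval, parabolaArc, parabolaPoint]

lemma arcEval_parabolaArcInfty : arcEval (parabolaArcInfty ε δ) 0 = ![0, 0, 1] := by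
  ext i
  fin_cases i <;> simp [arcEval, parabolaArcInfty]

lemma aeval_parabolaArc_parabola (ε' δ' : ℂ) : aeval (parabolaArc ε δ) (parabola c ε' δ') =
    Polynomial.C c * (Polynomial.C (ε' - ε) * Polynomial.X + Polynomial.C (δ' - δ)) := by
  rw [parabola, aeval_quad]
  simp only [parabolaArc, Polynomial.algebraMap_eq, Matrix.cons_val, map_mul, map_neg, map_sub,
    map_zero]
  ring

lemma aeval_parabolaArcInfty_parabola (ε' δ' : ℂ) :
    aeval (parabolaArcInfty ε δ) (parabola c ε' δ') = Polynomial.X ^ 3 *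
      (Polynomial.C c * (Polynomial.C (ε' - ε) + Polynomial.C (δ' - δ) * Polynomial.X)) := by
  rw [parabola, aeval_quad]
  simp only [parabolaArcInfty, Polynomial.algebraMap_eq, Matrix.cons_val, map_mul, map_neg, map_sub,
    map_zero]
  ring

lemma aeval_parabolaArc_contactConic : aeval (parabolaArc ε δ) (contactConic A B K) =
    -Polynomial.C A * (Polynomial.C ε * Polynomial.X + Polynomial.C δ) +
      Polynomial.C B * (Polynomial.X * (Polynomial.X ^ 2 + Polynomial.C ε * Polynomial.X +
        Polynomial.C δ)) +
      Polynomial.C K *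
        (Polynomial.X ^ 2 + Polynomial.C ε * Polynomial.X + Polynomial.C δ) ^ 2 := by
  rw [contactConic, aeval_quad]
  simp only [parabolaArc, Polynomial.algebraMap_eq, Matrix.cons_val, map_neg, map_zero]
  ring

lemma isArc_parabolaArc (t : ℂ) : IsArc (parabolaArc ε δ) t (parabola c ε δ) where
  immersive κ h := by
    have h0 := congrFun h 0
    have h1 := congrFun h 1
    simp only [parabolaArc, arcEval, Matrix.cons_val, Polynomial.derivative_X,
      Polynomial.derivative_one, Polynomial.eval_one, Polynomial.eval_zero, Polynomial.eval_X,
      Pi.smul_apply, smul_eq_mul, mul_one] at h0 h1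
    simp [← h1] at h0
  aeval_eq_zero := by simp [aeval_parabolaArc_parabola]

lemma isArc_parabolaArcInfty : IsArc (parabolaArcInfty ε δ) 0 (parabola c ε δ) where
  immersive κ h := by
    rw [arcEval_parabolaArcInfty] at h
    simpa [parabolaArcInfty] using congrFun h 0
  aeval_eq_zero := by simp [aeval_parabolaArcInfty_parabola]

end Parabola

section Intersection

variable {M : Frame} {P p q : Plane} {c ε δ : ℂ}

lemma hasCoords_of_eval_parabola_eq_zero (hc : c ≠ 0)
    (hP : eval P.rep (pull M (parabola c ε δ)) = 0) :
    HasCoords M P ![0, 0, 1] ∨ ∃ t, HasCoords M P (parabolaPoint ε δ t) := by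
  obtain ⟨v, hv⟩ : ∃ v, v = act M P.rep := ⟨_, rfl⟩
  have heq : v 0 ^ 2 + ε * v 0 * v 1 + δ * v 1 ^ 2 = v 1 * v 2 := by
    simpa [eval_pull, eval_parabola, ← hv, hc, sub_eq_zero] using hP
  by_cases h1 : v 1 = 0
  · have h0 : v 0 = 0 := by simpa [h1] using heq
    refine Or.inl (.of_act_eq_smul (a := v 2) ?_)
    ext i
    fin_cases i <;> simp [← hv, h0, h1]
  · refine Or.inr ⟨v 0 / v 1, .of_act_eq_smul (a := v 1) ?_⟩
    ext i
    fin_cases i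
    · simp [← hv, parabolaPoint, mul_div_cancel₀ _ h1]
    · simp [← hv, parabolaPoint]
    · simp only [← hv, parabolaPoint, Fin.reduceFinMk, Pi.smul_apply, Matrix.cons_val, smul_eq_mul]
      field_simp
      linear_combination -heq

lemma mem_parabola_inter_iff (hc : c ≠ 0) {F : Form} {n : ℕ} (hF : F.IsHomogeneous n) (P : Plane) :
    eval P.rep (pull M (parabola c ε δ)) = 0 ∧ eval P.rep (pull M F) = 0 ↔
      (HasCoords M P ![0, 0, 1] ∧ eval ![0, 0, 1] F = 0) ∨
        ∃ t, HasCoords M P (parabolaPoint ε δ t) ∧ (aeval (parabolaArc ε δ) F).eval t = 0 := by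
  simp only [polynomial_eval_aeval, arcEval_parabolaArc]
  constructor
  · rintro ⟨hP, hPF⟩
    rcases hasCoords_of_eval_parabola_eq_zero hc hP with h | ⟨t, h⟩
    · exact Or.inl ⟨h, (h.eval_eq_zero_iff hF).1 hPF⟩
    · exact Or.inr ⟨t, h, (h.eval_eq_zero_iff hF).1 hPF⟩
  · rintro (⟨h, hPF⟩ | ⟨t, h, hPF⟩)
    · refine ⟨(h.eval_eq_zero_iff isHomogeneous_parabola).2 ?_, (h.eval_eq_zero_iff hF).2 hPF⟩
      simp [eval_parabola]
    · refine ⟨(h.eval_eq_zero_iff isHomogeneous_parabola).2 ?_, (h.eval_eq_zero_iff hF).2 hPF⟩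
      simp [eval_parabola, parabolaPoint]

lemma HasCoords.iff_eq {v : Fin 3 → ℂ} (hp : HasCoords M p v) : HasCoords M P v ↔ P = p :=
  ⟨fun hP => hP.eq hp, fun h => h ▸ hp⟩

lemma HasCoords.not_parabolaPoint {x z : ℂ} (hp : HasCoords M P ![x, 0, z]) {t : ℂ} :
    ¬ HasCoords M P (parabolaPoint ε δ t) := by
  intro h
  obtain ⟨a, ha⟩ := h.exists_eq_smul hp
  simpa [parabolaPoint] using congrFun ha 1

lemma HasCoords.abscissa_eq {s t : ℂ} (hs : HasCoords M P (parabolaPoint ε δ s)) {ε' δ' : ℂ}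
    (ht : HasCoords M P (parabolaPoint ε' δ' t)) : s = t := by
  obtain ⟨a, ha⟩ := hs.exists_eq_smul ht
  have h0 : s = a * t := congrFun ha 0
  have h1 : 1 = a * 1 := congrFun ha 1
  linear_combination h0 - t * h1

variable (M) in
lemma exists_hasCoords_parabolaPoint (ε δ t : ℂ) :
    ∃ P, HasCoords M P (parabolaPoint ε δ t) :=
  exists_hasCoords M fun h => by simpa [parabolaPoint] using congrFun h 1

lemma isContactPair_parabola_parabola {c' ε' δ' : ℂ} (hc : c ≠ 0) (hc' : c' ≠ 0) (hε : ε' ≠ ε)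
    (hp : HasCoords M p ![0, 0, 1])
    (hq : HasCoords M q (parabolaPoint ε δ (-(δ' - δ) / (ε' - ε)))) :
    IsContactPair (pull M (parabola c ε δ)) (pull M (parabola c' ε' δ')) p q := by
  have hκ : c' * (ε' - ε) ≠ 0 := mul_ne_zero hc' (sub_ne_zero.2 hε)
  have hrestr : aeval (parabolaArc ε δ) (parabola c' ε' δ') =
      (Polynomial.X - Polynomial.C (-(δ' - δ) / (ε' - ε))) ^ (0 + 1) *
        Polynomial.C (c' * (ε' - ε)) := by
    refine Polynomial.funext fun t => ?_
    simp only [aeval_parabolaArc_parabola, Polynomial.eval_mul, Polynomial.eval_add,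
      Polynomial.eval_sub, Polynomial.eval_C, Polynomial.eval_X, zero_add, pow_one]
    field_simp [sub_ne_zero.2 hε]
    ring
  have hrestr_infty : aeval (parabolaArcInfty ε δ) (parabola c' ε' δ') =
      (Polynomial.X - Polynomial.C 0) ^ (2 + 1) * (Polynomial.C c' *
        (Polynomial.C (ε' - ε) + Polynomial.C (δ' - δ) * Polynomial.X)) := by
    rw [aeval_parabolaArcInfty_parabola, Polynomial.C_0, sub_zero]
  refine ⟨?_, fun P => ?_, fun hK hKp => ?_, fun hK hKq => ?_⟩
  · rintro rfl
    exact hp.not_parabolaPoint hq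
  · have hroot (t : ℂ) : (aeval (parabolaArc ε δ) (parabola c' ε' δ')).eval t = 0 ↔
        t = -(δ' - δ) / (ε' - ε) := by
      simp [hrestr, hc', sub_eq_zero, hε]
    simp only [mem_parabola_inter_iff hc isHomogeneous_parabola, hroot, hp.iff_eq, ← hq.iff_eq,
      eval_parabola]
    simp
  · have hp' : HasCoords M p (arcEval (parabolaArcInfty ε δ) 0) := by
      rwa [arcEval_parabolaArcInfty]
    exact (isArc_parabolaArcInfty c ε δ).isTypeA_pull_mul isHomogeneous_parabola
      (isSmooth_parabola hc) hp' isHomogeneous_parabola (isSmooth_parabola hc')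
      (by simpa using hκ) hrestr_infty hK hKp
  · exact (isArc_parabolaArc c ε δ _).isTypeA_pull_mul isHomogeneous_parabola
      (isSmooth_parabola hc) ((arcEval_parabolaArc ..).symm ▸ hq) isHomogeneous_parabola
      (isSmooth_parabola hc') (by simpa using hκ) hrestr hK hKq

lemma isContactPair_parabola {F : Form} {n : ℕ} {a b κ : ℂ} (hc : c ≠ 0) (hF : F.IsHomogeneous n)
    (hFs : IsSmooth F) (hF_infty : eval ![0, 0, 1] F ≠ 0) (hκ : κ ≠ 0) (hab : a ≠ b)
    (hrestr : aeval (parabolaArc ε δ) F = Polynomial.C κ *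
      ((Polynomial.X - Polynomial.C a) ^ 3 * (Polynomial.X - Polynomial.C b)))
    (hp : HasCoords M p (parabolaPoint ε δ a)) (hq : HasCoords M q (parabolaPoint ε δ b)) :
    IsContactPair (pull M (parabola c ε δ)) (pull M F) p q := by
  refine ⟨?_, fun P => ?_, fun hK hKp => ?_, fun hK hKq => ?_⟩
  · rintro rfl
    exact hab (hp.abscissa_eq hq)
  · have hroot (t : ℂ) : (aeval (parabolaArc ε δ) F).eval t = 0 ↔ t = a ∨ t = b := by
      simp [hrestr, hκ, sub_eq_zero]
    simp only [mem_parabola_inter_iff hc hF, hroot, hF_infty, and_false, false_or, and_or_left,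
      exists_or, exists_eq_right, hp.iff_eq, hq.iff_eq]
  · have hrestr' : aeval (parabolaArc ε δ) F = (Polynomial.X - Polynomial.C a) ^ (2 + 1) *
        (Polynomial.C κ * (Polynomial.X - Polynomial.C b)) := by
      rw [hrestr, mul_left_comm]
    exact (isArc_parabolaArc c ε δ a).isTypeA_pull_mul isHomogeneous_parabola
      (isSmooth_parabola hc) ((arcEval_parabolaArc ..).symm ▸ hp) hF hFs
      (by simp [hκ, sub_eq_zero, hab]) hrestr' hK hKp
  · have hrestr' : aeval (parabolaArc ε δ) F = (Polynomial.X - Polynomial.C b) ^ (0 + 1) *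
        (Polynomial.C κ * (Polynomial.X - Polynomial.C a) ^ 3) := by
      rw [hrestr]
      ring
    exact (isArc_parabolaArc c ε δ b).isTypeA_pull_mul isHomogeneous_parabola
      (isSmooth_parabola hc) ((arcEval_parabolaArc ..).symm ▸ hq) hF hFs
      (by simp [hκ, sub_eq_zero, hab.symm]) hrestr' hK hKq

end Intersection

/-! ### Osculating contact conics -/

/-- The equations for the conic `contactConic A B K` to meet the parabola `w = u² + u + δ` at the
abscissa `r` with multiplicity at least three: the vanishing of the restriction and of its first
two derivatives. -/
structure IsOsculating (δ r A B K : ℂ) : Prop where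
  value : -A * (r + δ) + B * (r * (r ^ 2 + r + δ)) + K * (r ^ 2 + r + δ) ^ 2 = 0
  slope : -A + B * ((r ^ 2 + r + δ) + r * (2 * r + 1)) +
    2 * K * (r ^ 2 + r + δ) * (2 * r + 1) = 0
  curvature : B * (3 * r + 1) + K * (6 * r ^ 2 + 6 * r + 1 + 2 * δ) = 0

/-- An osculating contact conic in general position: it is smooth, its intersection numbers with
`w = u²` and `w = u² + u + δ` are exactly three, the three conics have no common point, and it is
determined by `r` up to a scalar. -/
structure IsGeneralOsculating (δ r A B K : ℂ) : Prop extends IsOsculating δ r A B K where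
  δ_ne : δ ≠ 0
  A_ne : A ≠ 0
  B_ne : B ≠ 0
  K_ne : K ≠ 0
  r_ne : 3 * r + 1 ≠ 0
  no_triple_point : B - K * δ ≠ 0
  exact_contact : 2 * (2 * r + 1) * K + B ≠ 0

lemma pow_three_dvd_iff (p : Polynomial ℂ) (r : ℂ) :
    (Polynomial.X - Polynomial.C r) ^ 3 ∣ p ↔ p.eval r = 0 ∧ p.derivative.eval r = 0 ∧
      p.derivative.derivative.eval r = 0 := by
  by_cases hp : p = 0
  · simp [hp]
  rw [← Polynomial.le_rootMultiplicity_iff hp, Nat.succ_le_iff,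
    Polynomial.lt_rootMultiplicity_iff_isRoot_iterate_derivative hp]
  constructor
  · exact fun h => ⟨h 0 (by norm_num), h 1 (by norm_num), h 2 (by norm_num)⟩
  · rintro ⟨h0, h1, h2⟩ m hm
    interval_cases m
    · exact h0
    · exact h1
    · exact h2

section Osculating

variable {δ r A B K : ℂ}

lemma isOsculating_iff : IsOsculating δ r A B K ↔
    (Polynomial.X - Polynomial.C r) ^ 3 ∣ aeval (parabolaArc 1 δ) (contactConic A B K) := by
  simp only [pow_three_dvd_iff, aeval_parabolaArc_contactConic, map_one, one_mul, pow_two,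
    Polynomial.derivative_add, Polynomial.derivative_mul, Polynomial.derivative_neg,
    Polynomial.derivative_C, Polynomial.derivative_X, Polynomial.derivative_one,
    Polynomial.derivative_zero,
    Polynomial.eval_add, Polynomial.eval_mul, Polynomial.eval_neg, Polynomial.eval_C,
    Polynomial.eval_X, Polynomial.eval_one, Polynomial.eval_zero]
  refine ⟨fun ⟨h0, h1, h2⟩ => ⟨?_, ?_, ?_⟩, fun ⟨h0, h1, h2⟩ => ⟨?_, ?_, ?_⟩⟩
  · linear_combination h0
  · linear_combination h1
  · linear_combination 2 * h2
  · linear_combination h0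
  · linear_combination h1
  · linear_combination h2 / 2

lemma IsOsculating.aeval_parabolaArc_eq (h : IsOsculating δ r A B K) :
    aeval (parabolaArc 1 δ) (contactConic A B K) = (Polynomial.X - Polynomial.C r) ^ 3 *
      (Polynomial.C K * Polynomial.X + Polynomial.C ((3 * r + 2) * K + B)) := by
  refine Polynomial.funext fun t => ?_
  simp only [aeval_parabolaArc_contactConic, Polynomial.eval_add, Polynomial.eval_sub,
    Polynomial.eval_mul, Polynomial.eval_neg, Polynomial.eval_pow, Polynomial.eval_C,
    Polynomial.eval_X]
  linear_combination h.value + (t - r) * h.slope + (t - r) ^ 2 * h.curvature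

lemma aeval_parabolaArc_zero_contactConic : aeval (parabolaArc 0 0) (contactConic A B K) =
    Polynomial.X ^ 3 * (Polynomial.C K * Polynomial.X + Polynomial.C B) := by
  simp only [aeval_parabolaArc_contactConic, map_zero]
  ring

lemma C_mul_X_add_C_eq (hK : K ≠ 0) :
    Polynomial.C K * Polynomial.X + Polynomial.C B =
      Polynomial.C K * (Polynomial.X - Polynomial.C (-B / K)) := by
  rw [mul_sub, ← Polynomial.C_mul, mul_div_cancel₀ _ hK, Polynomial.C_neg, sub_neg_eq_add]

lemma IsGeneralOsculating.eval_ne_zero (h : IsGeneralOsculating δ r A B K) :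
    eval (parabolaPoint 0 0 (-δ)) (contactConic A B K) ≠ 0 := by
  rw [← arcEval_parabolaArc, ← polynomial_eval_aeval, aeval_parabolaArc_zero_contactConic]
  have heval : (Polynomial.X ^ 3 * (Polynomial.C K * Polynomial.X + Polynomial.C B)).eval (-δ) =
      -(δ ^ 3 * (B - K * δ)) := by
    simp only [Polynomial.eval_mul, Polynomial.eval_add, Polynomial.eval_pow, Polynomial.eval_X,
      Polynomial.eval_C]
    ring
  rw [heval]
  exact neg_ne_zero.2 (mul_ne_zero (pow_ne_zero 3 h.δ_ne) h.no_triple_point)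

theorem IsGeneralOsculating.hasSingularities (h : IsGeneralOsculating δ r A B K) {M : Frame}
    {c c' : ℂ} (hc : c ≠ 0) (hc' : c' ≠ 0) {p₁ p₂ p₃ : Plane} (h₁ : HasCoords M p₁ ![0, 0, 1])
    (h₂ : HasCoords M p₂ (parabolaPoint 0 0 0)) (h₃ : HasCoords M p₃ (parabolaPoint 1 δ r)) :
    HasSingularities3A5And3A1
      (pull M (parabola c 0 0) * pull M (parabola c' 1 δ) * pull M (contactConic A B K))
      {p₁, p₂, p₃} := by
  have hK := h.K_ne
  have hsmooth := isSmooth_contactConic B K h.A_ne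
  have hH_infty : eval ![0, 0, 1] (contactConic A B K) ≠ 0 := by
    simpa [eval_contactConic] using hK
  obtain ⟨q₁, hq₁⟩ := exists_hasCoords_parabolaPoint M 0 0 (-δ)
  obtain ⟨q₂, hq₂⟩ := exists_hasCoords_parabolaPoint M 0 0 (-B / K)
  obtain ⟨q₃, hq₃⟩ := exists_hasCoords_parabolaPoint M 1 δ (-((3 * r + 2) * K + B) / K)
  have hFG : IsContactPair (pull M (parabola c 0 0)) (pull M (parabola c' 1 δ)) p₁ q₁ :=
    isContactPair_parabola_parabola hc hc' one_ne_zero h₁ (by simpa using hq₁)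
  refine hasSingularities3A5And3A1_mul (.pull M (isSmooth_parabola hc))
    (.pull M (isSmooth_parabola hc')) (.pull M hsmooth)
    (isHomogeneous_pull M isHomogeneous_parabola) (isHomogeneous_pull M isHomogeneous_parabola)
    (isHomogeneous_pull M (isHomogeneous_contactConic ..)) hFG
    (isContactPair_parabola hc (isHomogeneous_contactConic ..) hsmooth hH_infty hK ?_ ?_ h₂ hq₂)
    (isContactPair_parabola hc' (isHomogeneous_contactConic ..) hsmooth hH_infty hK ?_ ?_ h₃ hq₃)
    fun P hF hG hH => ?_
  · exact (div_ne_zero (neg_ne_zero.2 h.B_ne) hK).symm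
  · rw [aeval_parabolaArc_zero_contactConic, C_mul_X_add_C_eq hK, Polynomial.C_0, sub_zero]
    ring
  · rw [ne_eq, eq_div_iff hK]
    exact fun heq => h.exact_contact (by linear_combination heq)
  · rw [h.toIsOsculating.aeval_parabolaArc_eq, C_mul_X_add_C_eq hK]
    ring
  · rcases (hFG.mem_iff P).1 ⟨hF, hG⟩ with rfl | rfl
    · exact hH_infty ((h₁.eval_eq_zero_iff (isHomogeneous_contactConic ..)).1 hH)
    · exact h.eval_ne_zero ((hq₁.eval_eq_zero_iff (isHomogeneous_contactConic ..)).1 hH)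

end Osculating

/-! ### Sextics of torus type -/

section Torus

variable {F F₂ F₃ : Form} {c : ℂ}

lemma IsTorusType.pull (M : Frame) (h : IsTorusType F) : IsTorusType (pull M F) := by
  obtain ⟨c, hc, F₂, F₃, h2, h3, h2', h3', he⟩ := h
  refine ⟨c, hc, ThreeConics.pull M F₂, ThreeConics.pull M F₃,
    (map_ne_zero_iff _ (pull_injective M)).2 h2, (map_ne_zero_iff _ (pull_injective M)).2 h3,
    isHomogeneous_pull M h2', isHomogeneous_pull M h3', ?_⟩
  rw [← map_pow, ← map_pow, ← map_add, ← he, map_mul]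
  exact congrArg (· * _) ((ThreeConics.pull M).commutes c).symm

lemma isTorusType_pull_iff (M : Frame) : IsTorusType (pull M F) ↔ IsTorusType F :=
  ⟨fun h => pull_inv_pull M F ▸ h.pull M⁻¹, fun h => h.pull M⟩

lemma coeff_two_mul_mul {R : Type*} [CommRing R] {w a b : PowerSeries R}
    (ha : a.constantCoeff = 0) (hb : b.constantCoeff = 0) :
    PowerSeries.coeff 2 (w * (a * b)) =
      w.constantCoeff * (PowerSeries.coeff 1 a * PowerSeries.coeff 1 b) := by
  simp [PowerSeries.coeff_mul, Finset.Nat.antidiagonal_succ, ha, hb]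

lemma IsLocalCoordinates.exists_arc {u v : Germ} (h : IsLocalCoordinates u v) (a b : ℂ) :
    ∃ ψ : Germ →ₐ[ℂ] PowerSeries ℂ, (∀ x, (ψ x).constantCoeff = x.constantCoeff) ∧
      PowerSeries.coeff 1 (ψ u) = a ∧ PowerSeries.coeff 1 (ψ v) = b := by
  obtain ⟨-, -, hd⟩ := isLocalCoordinates_iff.1 h
  let κ := (linCoeff 0 u * linCoeff 1 v - linCoeff 1 u * linCoeff 0 v)⁻¹
  have hκ : κ * (linCoeff 0 u * linCoeff 1 v - linCoeff 1 u * linCoeff 0 v) = 1 :=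
    inv_mul_cancel₀ hd
  let s : Fin 2 → PowerSeries ℂ :=
    ![PowerSeries.C (κ * (a * linCoeff 1 v - b * linCoeff 1 u)) * PowerSeries.X,
      PowerSeries.C (κ * (b * linCoeff 0 u - a * linCoeff 0 v)) * PowerSeries.X]
  have hs : ∀ i, (s i).constantCoeff = 0 := fun i => by fin_cases i <;> simp [s]
  have hs0 : PowerSeries.coeff 1 (s 0) = κ * (a * linCoeff 1 v - b * linCoeff 1 u) := by simp [s]
  have hs1 : PowerSeries.coeff 1 (s 1) = κ * (b * linCoeff 0 u - a * linCoeff 0 v) := by simp [s]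
  refine ⟨restrict hs, constantCoeff_restrict hs, ?_, ?_⟩ <;>
    rw [coeff_one_restrict, hs0, hs1]
  · linear_combination a * hκ
  · linear_combination b * hκ

-- Along arcs, the quadratic terms exhibit `v² - u²` as the square of a linear form.
lemma IsLocalCoordinates.quadratic_eq_sq {u v w f g : Germ} (huv : IsLocalCoordinates u v)
    (hf : f.constantCoeff = 0) (he : w * (v ^ 2 - u ^ 2) = f ^ 3 + g ^ 2) :
    ∃ p q : ℂ, ∀ a b : ℂ, w.constantCoeff * (b ^ 2 - a ^ 2) = (p * a + q * b) ^ 2 := by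
  obtain ⟨hu, hv, -⟩ := isLocalCoordinates_iff.1 huv
  have hg : g.constantCoeff = 0 := by
    simpa [hf, hu, hv] using (congrArg MvPowerSeries.constantCoeff he).symm
  obtain ⟨p, q, hpq⟩ := huv.exists_eq_C_add g
  rw [hg, map_zero, zero_add] at hpq
  refine ⟨p.constantCoeff, q.constantCoeff, fun a b => ?_⟩
  obtain ⟨ψ, hψ, ha, hb⟩ := huv.exists_arc a b
  have hcoeff {y z : Germ} (k : Germ) (hy : y.constantCoeff = 0) (hz : z.constantCoeff = 0) :
      PowerSeries.coeff 2 (ψ (k * (y * z))) =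
        k.constantCoeff * (PowerSeries.coeff 1 (ψ y) * PowerSeries.coeff 1 (ψ z)) := by
    rw [map_mul ψ, map_mul ψ, coeff_two_mul_mul (by rw [hψ, hy]) (by rw [hψ, hz]), hψ]
  have hquad : w * (v * v) - w * (u * u) =
      f * (f * f) + p * p * (u * u) + 2 * p * q * (u * v) + q * q * (v * v) := by
    linear_combination he + (g + u * p + v * q) * hpq
  have h2 := congrArg (fun x => PowerSeries.coeff 2 (ψ x)) hquad
  rw [map_sub, map_sub, map_add, map_add, map_add, map_add, map_add, map_add, hcoeff _ hu hu,
    hcoeff _ hv hv, hcoeff _ hf hf, hcoeff _ hu hu, hcoeff _ hu hv, hcoeff _ hv hv] at h2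
  simp only [ha, hb, hf, map_mul, map_ofNat] at h2
  linear_combination h2

lemma IsGermOfTypeA.constantCoeff_ne_zero {x f g : Germ} (hx : IsGermOfTypeA 1 x)
    (he : x = f ^ 3 + g ^ 2) : f.constantCoeff ≠ 0 := by
  intro hf
  obtain ⟨u, v, w, huv, hw, rfl⟩ := hx
  obtain ⟨p, q, hpq⟩ := huv.quadratic_eq_sq hf he
  have hadd : p + q = 0 := by simpa using (hpq 1 1).symm
  have hsub : p - q = 0 := by simpa [← sub_eq_add_neg] using (hpq 1 (-1)).symm
  apply isUnit_mvPowerSeries_iff.1 hw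
  linear_combination hpq 0 1 + q / 2 * (hadd - hsub)

lemma isSingularPoint_of_torus (hc : c ≠ 0) (he : C c * F = F₂ ^ 3 + F₃ ^ 2) {P : Plane}
    (hF : eval P.rep F = 0) (hF₂ : eval P.rep F₂ = 0) : IsSingularPoint F P := by
  have hF₃ : eval P.rep F₃ = 0 := by
    simpa [hF, hF₂] using (congrArg (eval P.rep) he).symm
  refine ⟨hF, fun i => ?_⟩
  simpa [Derivation.leibniz, Derivation.leibniz_pow, hF₂, hF₃, hc] using
    congrArg (fun p => eval P.rep (pderiv i p)) he

lemma eval_ne_zero_of_isTypeA_one (hc : c ≠ 0) (he : C c * F = F₂ ^ 3 + F₃ ^ 2) {n : ℕ}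
    (h₂ : F₂.IsHomogeneous n) {P : Plane} (hP : IsTypeA 1 F P) : eval P.rep F₂ ≠ 0 := by
  rw [ne_eq, ← constantCoeff_germ_eq_zero_iff h₂]
  have hunit : IsUnit (germ (C c) P) :=
    isUnit_germ (isHomogeneous_C _ c) (by simpa using hc)
  refine (IsGermOfTypeA.mul_isUnit hP hunit).constantCoeff_ne_zero (g := germ F₃ P) ?_
  rw [mul_comm, ← germ_mul, he]
  simp [germ]

theorem HasSingularities3A5And3A1.mem_of_torus {S : Set Plane}
    (h : HasSingularities3A5And3A1 F S) (hc : c ≠ 0) (he : C c * F = F₂ ^ 3 + F₃ ^ 2) {n : ℕ}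
    (h₂ : F₂.IsHomogeneous n) {P : Plane} (hF : eval P.rep F = 0) (hF₂ : eval P.rep F₂ = 0) :
    P ∈ S := by
  obtain ⟨-, -, T, -, -, hT, hST⟩ := h
  have hmem : P ∈ S ∪ T := hST ▸ isSingularPoint_of_torus hc he hF hF₂
  exact hmem.resolve_right fun hPT => eval_ne_zero_of_isTypeA_one hc he h₂ (hT P hPT) hF₂

end Torus

-- The conic `F₂` restricts to the two parabolas as the squares `t²` and `(t - r)²`, which makes
-- `F₂³` minus the square of a cubic there.
lemma isTorusType_conics {c c' r : ℂ} (hc : c ≠ 0) (hc' : c' ≠ 0) (hr : 2 * r + 1 ≠ 0) :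
    IsTorusType (parabola c 0 0 * parabola c' 1 (-r / 2) *
      contactConic (-(r / 2) * (2 * r + 1) ^ 2) (-(2 * r + 1)) 1) := by
  let L : Form := C (-2 * (r + 1)) * X 0 + C (r * (2 * r + 1)) * X 1 + C 2 * X 2
  let F₂ : Form := quad (2 * r + 1) 0 0 0 (-2 * r) 0
  let F₃ : Form := C Complex.I * (X 0 ^ 3 + quad 1 0 0 0 (-1) 0 * L)
  have hX (i : Fin 3) : (X i : Form).IsHomogeneous 1 := isHomogeneous_X ℂ i
  have hL : L.IsHomogeneous 1 := (((hX 0).C_mul _).add ((hX 1).C_mul _)).add ((hX 2).C_mul _)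
  have hF₂ : eval ![1, 0, 0] F₂ = 2 * r + 1 := by simp [F₂, eval_quad]
  have hF₃ : eval ![1, 0, 0] F₃ = Complex.I * -(2 * r + 1) := by
    simp only [F₃, L, map_mul, map_add, map_pow, eval_quad, eval_C, eval_X, Matrix.cons_val]
    ring
  refine ⟨-4 / (c * c'), by simp [hc, hc'], F₂, F₃, fun h => hr ?_, fun h => hr ?_,
    isHomogeneous_quad .., (((hX 0).pow 3).add ((isHomogeneous_quad ..).mul hL)).C_mul _, ?_⟩
  · rw [← hF₂, h, map_zero]
  · exact neg_eq_zero.1 ((mul_eq_zero.1 (hF₃.symm.trans (by rw [h, map_zero]))).resolve_left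
      Complex.I_ne_zero)
  · refine MvPolynomial.funext fun v => ?_
    simp only [F₂, F₃, L, map_mul, map_add, map_pow, eval_C, eval_X, eval_quad, eval_parabola,
      eval_contactConic, mul_pow, Complex.I_sq]
    field_simp
    ring

lemma exists_eq_C_mul_pow {p : Polynomial ℂ} (hp : p ≠ 0) {r : ℂ}
    (h : ∀ x, p.eval x = 0 → x = r) :
    ∃ (κ : ℂ) (n : ℕ), κ ≠ 0 ∧ p = Polynomial.C κ * (Polynomial.X - Polynomial.C r) ^ n := by
  have hroots : p.roots = Multiset.replicate p.roots.card r :=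
    Multiset.eq_replicate_card.2 fun x hx => h x ((Polynomial.mem_roots hp).1 hx)
  have hprod := (IsAlgClosed.splits p).eq_prod_roots
  rw [hroots] at hprod
  exact ⟨p.leadingCoeff, p.roots.card, Polynomial.leadingCoeff_ne_zero.2 hp, by simpa using hprod⟩

lemma even_natDegree_of_cube_add_sq {R : Type*} [CommRing R] [IsDomain R] {p q : Polynomial R}
    (h : p ^ 3 + q ^ 2 = 0) : Even p.natDegree := by
  have hdeg := congrArg Polynomial.natDegree (eq_neg_of_add_eq_zero_left h)
  rw [Polynomial.natDegree_neg, Polynomial.natDegree_pow, Polynomial.natDegree_pow] at hdeg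
  grind

-- By parity of the degree, `p` is a multiple of `1`, `(X - r)²` or `(X - r)⁴`.
lemma coeff_eq_of_cube_add_sq {p q : Polynomial ℂ} {r : ℂ} (h : p ^ 3 + q ^ 2 = 0)
    (hdeg : p.natDegree ≤ 4) (hroot : ∀ x, p.eval x = 0 → x = r) :
    p.coeff 3 = -4 * r * p.coeff 4 ∧ (p.coeff 4 = 0 → p.coeff 1 = -2 * r * p.coeff 2 ∧
      (p.coeff 2 = 0 ∨ p.coeff 0 = r ^ 2 * p.coeff 2)) := by
  have hp : p ≠ 0 := by
    rintro rfl
    simpa using hroot (r + 1) Polynomial.eval_zero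
  have heven := even_natDegree_of_cube_add_sq h
  obtain ⟨κ, n, hκ, rfl⟩ := exists_eq_C_mul_pow hp hroot
  rw [Polynomial.natDegree_C_mul hκ, Polynomial.natDegree_pow, Polynomial.natDegree_X_sub_C,
    mul_one] at hdeg heven
  simp only [sub_eq_add_neg, ← map_neg, Polynomial.coeff_C_mul, Polynomial.coeff_X_add_C_pow]
  interval_cases n
  · simp [Nat.choose]
  · simp at heven
  · simp [Nat.choose]
    grind
  · exact absurd heven (by decide)
  · simp [Nat.choose]
    grind

lemma aeval_parabolaArc_quad (ε δ a b g d e k : ℂ) : aeval (parabolaArc ε δ) (quad a b g d e k) =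
    Polynomial.C k * Polynomial.X ^ 4 + Polynomial.C (g + 2 * k * ε) * Polynomial.X ^ 3 +
      Polynomial.C (a + g * ε + e + k * (ε ^ 2 + 2 * δ)) * Polynomial.X ^ 2 +
      Polynomial.C (b + g * δ + e * ε + 2 * k * ε * δ) * Polynomial.X +
      Polynomial.C (d + e * δ + k * δ ^ 2) := by
  simp only [aeval_quad, parabolaArc, Polynomial.algebraMap_eq, Matrix.cons_val, map_add, map_mul,
    map_pow, map_ofNat]
  ring

lemma eq_zero_of_quad_restrictions {δ r a b g d e k : ℂ} {q q' : Polynomial ℂ} (hr0 : r ≠ 0)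
    (hr1 : 2 * r + 1 ≠ 0) (hr2 : r + 2 * δ ≠ 0)
    (h : aeval (parabolaArc 0 0) (quad a b g d e k) ^ 3 + q ^ 2 = 0)
    (h' : aeval (parabolaArc 1 δ) (quad a b g d e k) ^ 3 + q' ^ 2 = 0)
    (hroot : ∀ t, eval (parabolaPoint 0 0 t) (quad a b g d e k) = 0 → t = 0)
    (hroot' : ∀ t, eval (parabolaPoint 1 δ t) (quad a b g d e k) = 0 → t = r) :
    a = 0 ∧ g = 0 ∧ k = 0 := by
  simp only [← arcEval_parabolaArc, ← polynomial_eval_aeval] at hroot hroot'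
  rw [aeval_parabolaArc_quad] at h h' hroot hroot'
  obtain ⟨hg, h012⟩ : g = 0 ∧ (k = 0 → b = 0 ∧ (a + e = 0 ∨ d = 0)) := by
    simpa [-map_add, -map_mul, -map_pow, Polynomial.coeff_X, Polynomial.coeff_C] using
      coeff_eq_of_cube_add_sq h (by compute_degree) hroot
  obtain ⟨h3, h012'⟩ : g + 2 * k = -(4 * r * k) ∧ (k = 0 →
      b + g * δ + e + 2 * k * δ = -(2 * r * (a + g + e + k * (1 + 2 * δ))) ∧
      (a + g + e + k * (1 + 2 * δ) = 0 ∨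
        d + e * δ + k * δ ^ 2 = r ^ 2 * (a + g + e + k * (1 + 2 * δ)))) := by
    simpa [-map_add, -map_mul, -map_pow, Polynomial.coeff_X, Polynomial.coeff_C] using
      coeff_eq_of_cube_add_sq h' (by compute_degree) hroot'
  have hk : k = 0 := by
    have hkr : k * (2 * r + 1) = 0 := by linear_combination (h3 - hg) / 2
    exact (mul_eq_zero.1 hkr).resolve_right hr1
  subst hg hk
  obtain ⟨rfl, hd⟩ := h012 rfl
  obtain ⟨he, hd'⟩ := h012' rfl
  have hae : a + e = 0 := by
    by_contra hae
    have hd := hd.resolve_left hae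
    have hd' := hd'.resolve_left fun h => hae (by linear_combination h)
    have hprod : (a + e) * (r * (r + 2 * δ)) = 0 := by linear_combination hd - hd' + δ * he
    exact mul_ne_zero hae (mul_ne_zero hr0 hr2) hprod
  exact ⟨by linear_combination (1 + 2 * r) * hae - he, rfl, rfl⟩

lemma HasCoords.ordinate_eq {M : Frame} {P : Plane} {ε ε' δ δ' s t : ℂ}
    (hs : HasCoords M P (parabolaPoint ε δ s)) (ht : HasCoords M P (parabolaPoint ε' δ' t)) :
    s ^ 2 + ε * s + δ = t ^ 2 + ε' * t + δ' := by
  obtain ⟨a, ha⟩ := hs.exists_eq_smul ht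
  have h1 : 1 = a * 1 := congrFun ha 1
  have h2 : s ^ 2 + ε * s + δ = a * (t ^ 2 + ε' * t + δ') := congrFun ha 2
  linear_combination h2 - (t ^ 2 + ε' * t + δ') * h1

namespace IsGeneralOsculating

variable {c c' δ r A B K : ℂ}

lemma r_add_ne (h : IsGeneralOsculating δ r A B K) : r + δ ≠ 0 := by
  intro hr
  obtain rfl : r = -δ := eq_neg_of_add_eq_zero_left hr
  refine mul_ne_zero (pow_ne_zero 3 h.δ_ne) h.no_triple_point ?_
  linear_combination -h.value

variable {c₀ : ℂ} {F₂ F₃ : Form}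

lemma hasCoords_of_torus (h : IsGeneralOsculating δ r A B K) (hc : c ≠ 0) (hc' : c' ≠ 0)
    (hc₀ : c₀ ≠ 0)
    (he : C c₀ * (parabola c 0 0 * parabola c' 1 δ * contactConic A B K) = F₂ ^ 3 + F₃ ^ 2)
    {n : ℕ} (h₂ : F₂.IsHomogeneous n) {P : Plane} {v : Fin 3 → ℂ} (hP : HasCoords 1 P v)
    (hv : eval v (parabola c 0 0 * parabola c' 1 δ * contactConic A B K) = 0)
    (hv₂ : eval v F₂ = 0) :
    HasCoords 1 P ![0, 0, 1] ∨ HasCoords 1 P (parabolaPoint 0 0 0) ∨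
      HasCoords 1 P (parabolaPoint 1 δ r) := by
  obtain ⟨p₁, h₁⟩ := exists_hasCoords 1 (v := ![0, 0, 1]) fun h => by simpa using congrFun h 2
  obtain ⟨p₂, h₂'⟩ := exists_hasCoords_parabolaPoint 1 0 0 0
  obtain ⟨p₃, h₃⟩ := exists_hasCoords_parabolaPoint 1 1 δ r
  have hS := h.hasSingularities hc hc' h₁ h₂' h₃
  have hF₂ := (hP.eval_eq_zero_iff h₂).2 hv₂
  have hF := (hP.eval_eq_zero_iff ((isHomogeneous_parabola.mul isHomogeneous_parabola).mul
    (isHomogeneous_contactConic (A := A) B K))).2 hv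
  simp only [pull_one] at hS hF hF₂
  rcases hS.mem_of_torus hc₀ he h₂ hF hF₂ with rfl | rfl | rfl
  · exact Or.inl h₁
  · exact Or.inr (Or.inl h₂')
  · exact Or.inr (Or.inr h₃)

lemma abscissa_eq_of_torus (h : IsGeneralOsculating δ r A B K) (hc : c ≠ 0) (hc' : c' ≠ 0)
    (hc₀ : c₀ ≠ 0)
    (he : C c₀ * (parabola c 0 0 * parabola c' 1 δ * contactConic A B K) = F₂ ^ 3 + F₃ ^ 2)
    {n : ℕ} (h₂ : F₂.IsHomogeneous n) :
    (∀ t, eval (parabolaPoint 0 0 t) F₂ = 0 → t = 0) ∧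
      ∀ t, eval (parabolaPoint 1 δ t) F₂ = 0 → t = r := by
  refine ⟨fun t ht => ?_, fun t ht => ?_⟩
  · obtain ⟨P, hP⟩ := exists_hasCoords_parabolaPoint 1 0 0 t
    have hv : eval (parabolaPoint 0 0 t) (parabola c 0 0) = 0 := by
      simp [eval_parabola, parabolaPoint]
    rcases h.hasCoords_of_torus hc hc' hc₀ he h₂ hP (by simp [hv]) ht with h₁ | h₂ | h₃
    · exact absurd hP h₁.not_parabolaPoint
    · exact hP.abscissa_eq h₂
    · refine absurd ?_ h.r_add_ne
      linear_combination -hP.ordinate_eq h₃ + (t + r) * hP.abscissa_eq h₃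
  · obtain ⟨P, hP⟩ := exists_hasCoords_parabolaPoint 1 1 δ t
    have hv : eval (parabolaPoint 1 δ t) (parabola c' 1 δ) = 0 := by
      simp [eval_parabola, parabolaPoint]
    rcases h.hasCoords_of_torus hc hc' hc₀ he h₂ hP (by simp [hv]) ht with h₁ | h₂ | h₃
    · exact absurd hP h₁.not_parabolaPoint
    · refine absurd ?_ h.δ_ne
      linear_combination hP.ordinate_eq h₂ - (t + 1) * hP.abscissa_eq h₂
    · exact hP.abscissa_eq h₃

theorem not_isTorusType (h : IsGeneralOsculating δ r A B K) (hc : c ≠ 0) (hc' : c' ≠ 0)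
    (hr0 : r ≠ 0) (hr1 : 2 * r + 1 ≠ 0) (hr2 : r + 2 * δ ≠ 0) :
    ¬ IsTorusType (parabola c 0 0 * parabola c' 1 δ * contactConic A B K) := by
  rintro ⟨c₀, hc₀, F₂, F₃, -, -, h₂, -, he⟩
  obtain ⟨a, b, g, d, e, k, rfl⟩ := exists_eq_quad h₂
  have hcube {φ : Fin 3 → Polynomial ℂ}
      (hφ : aeval φ (parabola c 0 0) = 0 ∨ aeval φ (parabola c' 1 δ) = 0) :
      aeval φ (quad a b g d e k) ^ 3 + aeval φ F₃ ^ 2 = 0 := by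
    rw [← map_pow, ← map_pow, ← map_add, ← he]
    rcases hφ with hφ | hφ <;> simp [hφ]
  obtain ⟨hroot, hroot'⟩ := h.abscissa_eq_of_torus hc hc' hc₀ he h₂
  obtain ⟨rfl, rfl, rfl⟩ := eq_zero_of_quad_restrictions hr0 hr1 hr2
    (hcube (.inl (isArc_parabolaArc c 0 0 0).aeval_eq_zero))
    (hcube (.inr (isArc_parabolaArc c' 1 δ 0).aeval_eq_zero)) hroot hroot'
  obtain ⟨t, ht⟩ := IsAlgClosed.exists_root
    (Polynomial.C A * Polynomial.X ^ 2 + Polynomial.C B * Polynomial.X + Polynomial.C K)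
    (by rw [Polynomial.degree_quadratic h.A_ne]; norm_num)
  simp only [Polynomial.IsRoot.def, Polynomial.eval_add, Polynomial.eval_mul, Polynomial.eval_pow,
    Polynomial.eval_C, Polynomial.eval_X] at ht
  obtain ⟨P, hP⟩ := exists_hasCoords 1 (v := ![t, 0, 1]) fun h => by simpa using congrFun h 2
  have hF₂ : eval ![t, 0, 1] (quad 0 b 0 d e 0) = 0 := by simp [eval_quad]
  have hH : eval ![t, 0, 1] (contactConic A B K) = 0 := by
    simpa [eval_contactConic] using ht
  rcases h.hasCoords_of_torus hc hc' hc₀ he h₂ hP (by simp [hH]) hF₂ with h₁ | h₂ | h₃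
  · obtain ⟨a, ha⟩ := hP.exists_eq_smul h₁
    obtain rfl : t = 0 := by simpa using congrFun ha 0
    exact h.K_ne (by simpa using ht)
  · exact hP.not_parabolaPoint h₂
  · exact hP.not_parabolaPoint h₃

end IsGeneralOsculating

/-! ### Parameters of the conical flex points -/

/-- The values of `δ` for which the configuration of `w = u²` and `w = u² + u + δ` is in general
position. -/
structure IsGeneralParam (δ : ℂ) : Prop where
  ne_zero : δ ≠ 0
  ne_quarter : 4 * δ - 1 ≠ 0
  ne_sixth : 6 * δ - 1 ≠ 0
  ne_third : 3 * δ - 1 ≠ 0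
  contact_ne : 48 * δ ^ 2 - 12 * δ + 1 ≠ 0
  B_ne : 16 * δ ^ 2 - 4 * δ + 1 ≠ 0
  triple_ne : 3 * δ ^ 2 - 3 * δ + 1 ≠ 0
  K_ne : 27 * δ ^ 2 - 9 * δ + 1 ≠ 0

-- Elimination of `A`, `B`, `K` from the three equations of an osculating conic.
lemma IsOsculating.flex_equation {δ r A B K : ℂ} (h : IsOsculating δ r A B K)
    (h0 : ¬ (A = 0 ∧ B = 0 ∧ K = 0)) :
    (r + 2 * δ) * (3 * r ^ 4 + 3 * r ^ 3 + r ^ 2 + δ * r + δ ^ 2) = 0 := by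
  obtain ⟨h1, h2, h3⟩ := h
  have h4 : B * (r * (r ^ 2 + r + δ) - (r + δ) * (r ^ 2 + r + δ + r * (2 * r + 1))) +
      K * ((r ^ 2 + r + δ) ^ 2 - 2 * (r + δ) * (r ^ 2 + r + δ) * (2 * r + 1)) = 0 := by
    linear_combination h1 - (r + δ) * h2
  set W := (r + 2 * δ) * (3 * r ^ 4 + 3 * r ^ 3 + r ^ 2 + δ * r + δ ^ 2) with hW
  have hB : B * W = 0 := by
    linear_combination -(6 * r ^ 2 + 6 * r + 1 + 2 * δ) * h4 + B * hW +
      ((r ^ 2 + r + δ) ^ 2 - 2 * (r + δ) * (r ^ 2 + r + δ) * (2 * r + 1)) * h3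
  have hK : K * W = 0 := by
    linear_combination (3 * r + 1) * h4 + K * hW -
      (r * (r ^ 2 + r + δ) - (r + δ) * (r ^ 2 + r + δ + r * (2 * r + 1))) * h3
  by_contra hW0
  obtain rfl : B = 0 := (mul_eq_zero.1 hB).resolve_right hW0
  obtain rfl : K = 0 := (mul_eq_zero.1 hK).resolve_right hW0
  exact h0 ⟨by linear_combination -h2, rfl, rfl⟩

lemma isGeneralOsculating_torus {δ r : ℂ} (hδ : IsGeneralParam δ) (hr : r = -2 * δ) :
    IsGeneralOsculating δ r (-(r / 2) * (2 * r + 1) ^ 2) (-(2 * r + 1)) 1 := by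
  have hδ0 := hδ.ne_zero
  have hm : 2 * r + 1 ≠ 0 := fun h => hδ.ne_quarter (by linear_combination 2 * hr - h)
  have hr0 : r ≠ 0 := by simp [hr, hδ0]
  exact
    { value := by rw [hr]; ring
      slope := by rw [hr]; ring
      curvature := by rw [hr]; ring
      δ_ne := hδ0
      A_ne := by simp [hr0, hm]
      B_ne := neg_ne_zero.2 hm
      K_ne := one_ne_zero
      r_ne := fun h => hδ.ne_sixth (by linear_combination 3 * hr - h)
      no_triple_point := fun h => hδ.ne_third (by linear_combination h + 2 * hr)
      exact_contact := fun h => hm (by linear_combination h) }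

section CubeRoot

variable {δ r w : ℂ}

lemma two_mul_add_one_ne_zero (hw : w ^ 2 + w + 1 = 0) : 2 * w + 1 ≠ 0 := by
  intro h
  have h3 : (3 : ℂ) = 0 := by linear_combination 4 * hw - (2 * w + 1) * h
  norm_num at h3

lemma IsGeneralParam.ne_of_cube_root (hδ : IsGeneralParam δ) (hw : w ^ 2 + w + 1 = 0)
    (hr : δ = w * r + (2 * w + 1) * r ^ 2) : r ≠ 0 ∧ 2 * r + 1 ≠ 0 ∧ r + 2 * δ ≠ 0 := by
  have hr0 : r ≠ 0 := by
    rintro rfl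
    exact hδ.ne_zero (by linear_combination hr)
  have hm : 2 * r + 1 ≠ 0 := by
    intro h
    obtain rfl : r = -1 / 2 := by linear_combination h / 2
    exact hδ.ne_quarter (by linear_combination 4 * hr)
  refine ⟨hr0, hm, fun h => ?_⟩
  have hprod : r * (2 * r + 1) * (2 * w + 1) = 0 := by linear_combination h - 2 * hr
  exact mul_ne_zero (mul_ne_zero hr0 hm) (two_mul_add_one_ne_zero hw) hprod

lemma IsGeneralParam.three_mul_add_one_ne_zero (hδ : IsGeneralParam δ) (hw : w ^ 2 + w + 1 = 0)
    (hr : δ = w * r + (2 * w + 1) * r ^ 2) : 3 * r + 1 ≠ 0 := by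
  intro h
  obtain rfl : r = -1 / 3 := by linear_combination h / 3
  apply hδ.K_ne
  rw [hr]
  linear_combination hw / 3

lemma IsGeneralParam.cube_root_B_ne (hδ : IsGeneralParam δ) (hw : w ^ 2 + w + 1 = 0)
    (hr : δ = w * r + (2 * w + 1) * r ^ 2) : (4 + 2 * w) * r + 1 ≠ 0 := by
  intro h
  obtain rfl : r = -(1 - w) / 6 := by linear_combination (2 - 2 * w) / 12 * h + r / 3 * hw
  obtain rfl : δ = -w / 4 := by linear_combination hr + (2 * w + 1) / 36 * hw
  exact hδ.B_ne (by linear_combination hw)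

lemma IsGeneralParam.cube_root_no_triple_point (hδ : IsGeneralParam δ) (hw : w ^ 2 + w + 1 = 0)
    (hr : δ = w * r + (2 * w + 1) * r ^ 2) :
    -(2 * r + 1) * ((4 + 2 * w) * r + 1) - (3 * r + 1) * δ ≠ 0 := by
  intro h
  have hcube : ((2 + w) * r + 1) ^ 3 = 0 := by
    linear_combination ((w + 5) * r ^ 3 + 3 * r ^ 2) * hw - h - (3 * r + 1) * hr
  have hlin : (2 + w) * r + 1 = 0 := eq_zero_of_pow_eq_zero hcube
  obtain rfl : r = -(1 - w) / 3 := by linear_combination (1 - w) / 3 * hlin + r / 3 * hw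
  obtain rfl : δ = (1 - w) / 3 := by linear_combination hr + 2 * (w - 1) / 9 * hw
  exact hδ.triple_ne (by linear_combination hw / 3)

lemma IsGeneralParam.cube_root_exact_contact (hδ : IsGeneralParam δ) (hw : w ^ 2 + w + 1 = 0)
    (hr : δ = w * r + (2 * w + 1) * r ^ 2) :
    2 * (2 * r + 1) * (3 * r + 1) + -(2 * r + 1) * ((4 + 2 * w) * r + 1) ≠ 0 := by
  intro h
  have hprod : (2 * r + 1) * ((2 - 2 * w) * r + 1) = 0 := by linear_combination h
  have hlin := (mul_eq_zero.1 hprod).resolve_left (hδ.ne_of_cube_root hw hr).2.1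
  obtain rfl : r = -(2 + w) / 6 := by linear_combination (4 + 2 * w) / 12 * hlin + r / 3 * hw
  obtain rfl : δ = (1 - w) / 12 := by linear_combination hr + (2 * w + 1) / 36 * hw
  exact hδ.contact_ne (by linear_combination hw / 3)

lemma isGeneralOsculating_cube_root (hδ : IsGeneralParam δ) (hw : w ^ 2 + w + 1 = 0)
    (hr : δ = w * r + (2 * w + 1) * r ^ 2) :
    IsGeneralOsculating δ r (w * r * (2 * r + 1) ^ 2)
      (-(2 * r + 1) * ((4 + 2 * w) * r + 1)) (3 * r + 1) := by
  obtain ⟨hr0, hm, -⟩ := hδ.ne_of_cube_root hw hr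
  have hw0 : w ≠ 0 := by
    rintro rfl
    norm_num at hw
  have hK := hδ.three_mul_add_one_ne_zero hw hr
  exact
    { value := by
        rw [hr]
        linear_combination (-(r ^ 3 * (2 * r + 1) ^ 2)) * hw
      slope := by
        rw [hr]
        linear_combination (-2 * r ^ 2 * (2 * r + 1) ^ 2) * hw
      curvature := by rw [hr]; ring
      δ_ne := hδ.ne_zero
      A_ne := by simp [hw0, hr0, hm]
      B_ne := mul_ne_zero (neg_ne_zero.2 hm) (hδ.cube_root_B_ne hw hr)
      K_ne := hK
      r_ne := hK
      no_triple_point := hδ.cube_root_no_triple_point hw hr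
      exact_contact := hδ.cube_root_exact_contact hw hr }

end CubeRoot

lemma exists_roots_of_discrim_ne_zero {a b c : ℂ} (ha : a ≠ 0) (hd : discrim a b c ≠ 0) :
    ∃ x y : ℂ, x ≠ y ∧ ∀ t, a * (t * t) + b * t + c = 0 ↔ t = x ∨ t = y := by
  obtain ⟨s, hs⟩ := IsAlgClosed.exists_eq_mul_self (discrim a b c)
  refine ⟨_, _, fun h => hd ?_, quadratic_eq_zero_iff ha hs⟩
  rw [div_left_inj' (mul_ne_zero two_ne_zero ha)] at h
  linear_combination hs + s / 2 * h

lemma IsGeneralParam.exists_roots_of_cube_root {δ w : ℂ} (hδ : IsGeneralParam δ)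
    (hw : w ^ 2 + w + 1 = 0) :
    ∃ x y : ℂ, x ≠ y ∧ ∀ t, δ = w * t + (2 * w + 1) * t ^ 2 ↔ t = x ∨ t = y := by
  have hdisc : discrim (2 * w + 1) w (-δ) ≠ 0 := by
    intro h
    rw [discrim] at h
    apply hδ.contact_ne
    linear_combination (w - 4 * (2 * w + 1) * δ) * h +
      (64 * δ ^ 2 - w + 1 - 4 * δ * (3 - 2 * w)) * hw
  obtain ⟨x, y, hxy, hroots⟩ :=
    exists_roots_of_discrim_ne_zero (two_mul_add_one_ne_zero hw) hdisc
  refine ⟨x, y, hxy, fun t => ?_⟩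
  rw [← hroots, eq_comm, ← sub_eq_zero]
  ring_nf

-- Over the cube roots of unity the quartic factor of the flex equation splits into the quadratics
-- `(2 w + 1) r² + w r - δ` for the two roots `w` of `w² + w + 1`.
theorem IsGeneralParam.exists_flex_params {δ : ℂ} (hδ : IsGeneralParam δ) :
    ∃ r : Fin 5 → ℂ, Function.Injective r ∧ r 0 = -2 * δ ∧
      (∀ i ≠ 0, ∃ w, w ^ 2 + w + 1 = 0 ∧ δ = w * r i + (2 * w + 1) * r i ^ 2) ∧
      ∀ x, (x + 2 * δ) * (3 * x ^ 4 + 3 * x ^ 3 + x ^ 2 + δ * x + δ ^ 2) = 0 → ∃ i, r i = x := by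
  obtain ⟨w, hw⟩ := IsAlgClosed.exists_root (Polynomial.C 1 * Polynomial.X ^ 2 +
    Polynomial.C (1 : ℂ) * Polynomial.X + Polynomial.C 1)
    (by rw [Polynomial.degree_quadratic one_ne_zero]; norm_num)
  replace hw : w ^ 2 + w + 1 = 0 := by simpa using hw
  have hv : (-1 - w) ^ 2 + (-1 - w) + 1 = 0 := by linear_combination hw
  obtain ⟨x₁, y₁, hxy₁, h₁⟩ := hδ.exists_roots_of_cube_root hw
  obtain ⟨x₂, y₂, hxy₂, h₂⟩ := hδ.exists_roots_of_cube_root hv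
  have hdisj {t : ℂ} (ht : t = x₁ ∨ t = y₁) : ¬ (t = x₂ ∨ t = y₂) := by
    rw [← h₁] at ht
    rw [← h₂]
    intro ht'
    obtain ⟨h0, h1, -⟩ := hδ.ne_of_cube_root hw ht
    apply mul_ne_zero (mul_ne_zero h0 h1) (two_mul_add_one_ne_zero hw)
    linear_combination ht' - ht
  have hne {t v : ℂ} (hv : v ^ 2 + v + 1 = 0) (ht : δ = v * t + (2 * v + 1) * t ^ 2) :
      -(2 * δ) ≠ t :=
    fun h => (hδ.ne_of_cube_root hv ht).2.2 (by linear_combination -h)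
  have hx₁ := (h₁ x₁).2 (.inl rfl)
  have hy₁ := (h₁ y₁).2 (.inr rfl)
  have hx₂ := (h₂ x₂).2 (.inl rfl)
  have hy₂ := (h₂ y₂).2 (.inr rfl)
  refine ⟨![-2 * δ, x₁, y₁, x₂, y₂], List.nodup_ofFn.1 ?_, rfl, ?_, fun x hx => ?_⟩
  · have hx := hdisj (.inl rfl)
    have hy := hdisj (.inr rfl)
    rw [not_or] at hx hy
    simp [hne hw hx₁, hne hw hy₁, hne hv hx₂, hne hv hy₂, hxy₁, hxy₂, hx, hy]
  · simpa [Fin.forall_fin_succ] using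
      ⟨⟨w, hw, hx₁⟩, ⟨w, hw, hy₁⟩, ⟨_, hv, hx₂⟩, ⟨_, hv, hy₂⟩⟩
  · have hfactor : (x + 2 * δ) * ((δ - (w * x + (2 * w + 1) * x ^ 2)) *
        (δ - ((-1 - w) * x + (2 * (-1 - w) + 1) * x ^ 2))) = 0 := by
      linear_combination hx + (x + 2 * δ) * (-(4 * x ^ 4 + 4 * x ^ 3 + x ^ 2)) * hw
    rw [mul_eq_zero, mul_eq_zero, sub_eq_zero, sub_eq_zero, h₁, h₂] at hfactor
    rcases hfactor with h | (rfl | rfl) | rfl | rfl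
    · exact ⟨0, by simp only [Matrix.cons_val]; linear_combination -h⟩
    exacts [⟨1, rfl⟩, ⟨2, rfl⟩, ⟨3, rfl⟩, ⟨4, rfl⟩]

/-! ### The linear system and its conical flex points -/

/-- The linear system of the conics `contactConic A B K` in the coordinates `M`, parametrized by
`(A, B, K)`. -/
def contactFamily (M : Frame) : (Fin 3 → ℂ) →ₗ[ℂ] Form where
  toFun x := pull M (contactConic (x 0) (x 1) (x 2))
  map_add' x y := by
    rw [← map_add]
    congr 1
    refine MvPolynomial.funext fun v => ?_
    simp only [map_add, eval_contactConic, Pi.add_apply]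
    ring
  map_smul' a x := by
    rw [RingHom.id_apply, ← map_smul]
    congr 1
    refine MvPolynomial.funext fun v => ?_
    simp only [smul_eval, eval_contactConic, Pi.smul_apply, smul_eq_mul]
    ring

lemma contactFamily_apply (M : Frame) (x : Fin 3 → ℂ) :
    contactFamily M x = pull M (contactConic (x 0) (x 1) (x 2)) := rfl

lemma contactFamily_injective (M : Frame) : Function.Injective (contactFamily M) := by
  rw [← LinearMap.ker_eq_bot, LinearMap.ker_eq_bot']
  intro x hx
  rw [contactFamily_apply, map_eq_zero_iff _ (pull_injective M)] at hx
  have hval (v : Fin 3 → ℂ) :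
      x 0 * (v 0 ^ 2 - v 1 * v 2) + x 1 * (v 0 * v 2) + x 2 * v 2 ^ 2 = 0 := by
    rw [← eval_contactConic, hx, map_zero]
  have h0 : x 0 = 0 := by simpa using hval ![1, 0, 0]
  have h2 : x 2 = 0 := by simpa using hval ![0, 0, 1]
  have h1 : x 1 = 0 := by simpa [h0, h2] using hval ![1, 0, 1]
  ext i
  fin_cases i <;> assumption

lemma finrank_range_contactFamily (M : Frame) :
    Module.finrank ℂ (LinearMap.range (contactFamily M)) = 3 := by
  rw [LinearMap.finrank_range_of_inj (contactFamily_injective M), Module.finrank_fin_fun]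

lemma pow_three_dvd_aeval_parabolaArc_zero_iff {F : Form} (hF : F.IsHomogeneous 2) :
    Polynomial.X ^ 3 ∣ aeval (parabolaArc 0 0) F ↔ ∃ A B K, contactConic A B K = F := by
  constructor
  · intro h
    obtain ⟨a, b, g, d, e, k, rfl⟩ := exists_eq_quad hF
    rw [← sub_zero Polynomial.X, ← Polynomial.C_0, pow_three_dvd_iff, aeval_quad] at h
    obtain ⟨rfl, rfl, h2⟩ : d = 0 ∧ b = 0 ∧ a * 2 + e * 2 = 0 := by
      simpa [parabolaArc, Polynomial.algebraMap_eq, pow_two, ← two_mul] using h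
    obtain rfl : e = -a := by linear_combination h2 / 2
    exact ⟨a, g, k, rfl⟩
  · rintro ⟨A, B, K, rfl⟩
    exact ⟨_, aeval_parabolaArc_zero_contactConic⟩

section Osculation

variable {M : Frame} {c δ r t A B K : ℂ} {P : Plane}

lemma mem_range_contactFamily_iff (hc : c ≠ 0) (hP : HasCoords M P (parabolaPoint 0 0 0))
    (F : Form) : F ∈ LinearMap.range (contactFamily M) ↔
      F.IsHomogeneous 2 ∧ 3 ≤ interMult (pull M (parabola c 0 0)) F P := by
  have hle {F : Form} (hF : F.IsHomogeneous 2) :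
      3 ≤ interMult (pull M (parabola c 0 0)) (pull M F) P ↔ ∃ A B K, contactConic A B K = F := by
    rw [← pow_three_dvd_aeval_parabolaArc_zero_iff hF]
    simpa using (isArc_parabolaArc c 0 0 0).le_interMult_pull_iff isHomogeneous_parabola
      (isSmooth_parabola hc) (by rwa [arcEval_parabolaArc]) hF 3
  constructor
  · rintro ⟨x, rfl⟩
    exact ⟨isHomogeneous_pull M (isHomogeneous_contactConic ..),
      (hle (isHomogeneous_contactConic ..)).2 ⟨_, _, _, rfl⟩⟩
  · rintro ⟨hF, h3⟩
    have hpull : pull M (pull M⁻¹ F) = F := by simpa using pull_inv_pull M⁻¹ F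
    rw [← hpull] at h3
    obtain ⟨A, B, K, hABK⟩ := (hle (isHomogeneous_pull M⁻¹ hF)).1 h3
    exact ⟨![A, B, K], by rw [← hpull, ← hABK]; rfl⟩

lemma three_le_interMult_contactConic_iff (hc : c ≠ 0) (hP : HasCoords M P (parabolaPoint 1 δ t)) :
    3 ≤ interMult (pull M (parabola c 1 δ)) (pull M (contactConic A B K)) P ↔
      IsOsculating δ t A B K := by
  rw [isOsculating_iff]
  exact (isArc_parabolaArc c 1 δ t).le_interMult_pull_iff isHomogeneous_parabola
    (isSmooth_parabola hc) (by rwa [arcEval_parabolaArc]) (isHomogeneous_contactConic ..) 3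

lemma IsGeneralOsculating.exists_eq_smul (h : IsGeneralOsculating δ r A B K) {x : Fin 3 → ℂ}
    (hx : IsOsculating δ r (x 0) (x 1) (x 2)) : ∃ a : ℂ, x = a • ![A, B, K] := by
  have hB : x 1 * K = x 2 * B :=
    mul_left_cancel₀ h.r_ne (by linear_combination K * hx.curvature - x 2 * h.curvature)
  have hA : x 0 * K = x 2 * A := by
    linear_combination x 2 * h.slope - K * hx.slope +
      ((r ^ 2 + r + δ) + r * (2 * r + 1)) * hB
  have hK := h.K_ne
  refine ⟨x 2 / K, funext <| Fin.forall_fin_succ.2 ⟨?_, Fin.forall_fin_two.2 ⟨?_, ?_⟩⟩⟩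
  · simp [div_mul_eq_mul_div, eq_div_iff hK, hA]
  · simp [div_mul_eq_mul_div, eq_div_iff hK, hB]
  · simp [hK]

lemma isConicalFlex_range_contactFamily_iff (hc : c ≠ 0) :
    IsConicalFlex (LinearMap.range (contactFamily M)) (pull M (parabola c 1 δ)) P ↔
      HasCoords M P ![0, 0, 1] ∨ ∃ t, HasCoords M P (parabolaPoint 1 δ t) ∧
        ∃ x : Fin 3 → ℂ, x ≠ 0 ∧ IsOsculating δ t (x 0) (x 1) (x 2) := by
  have hsmooth : IsSmooth (parabola c 1 δ) := isSmooth_parabola hc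
  have hmem : eval P.rep (pull M (parabola c 1 δ)) = 0 ↔
      HasCoords M P ![0, 0, 1] ∨ ∃ t, HasCoords M P (parabolaPoint 1 δ t) := by
    simpa [aeval_parabolaArc_parabola, eval_parabola] using
      mem_parabola_inter_iff (M := M) (ε := 1) (δ := δ) hc
        (isHomogeneous_parabola (c := c) (ε := 1) (δ := δ)) P
  have hinj {x : Fin 3 → ℂ} : contactFamily M x ≠ 0 ↔ x ≠ 0 :=
    map_ne_zero_iff _ (contactFamily_injective M)
  rw [IsConicalFlex, finrank_range_contactFamily, IsSmoothPoint, hmem]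
  constructor
  · rintro ⟨⟨hP | ⟨t, hP⟩, -⟩, _, ⟨x, rfl⟩, hx, h3⟩
    · exact .inl hP
    · exact .inr ⟨t, hP, x, hinj.1 hx, (three_le_interMult_contactConic_iff hc hP).1 h3⟩
  · rintro (hP | ⟨t, hP, x, hx, hosc⟩)
    · refine ⟨⟨.inl hP, hsmooth.pull M _ P.rep_nonzero⟩, _, ⟨![1, 0, 0], rfl⟩, hinj.2 ?_, ?_⟩
      · exact fun h => one_ne_zero (congrFun h 0)
      · have hpar : contactConic 1 0 0 = parabola 1 0 0 := by simp [contactConic, parabola]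
        refine ((isArc_parabolaArcInfty c 1 δ).le_interMult_pull_iff isHomogeneous_parabola hsmooth
          (by rwa [arcEval_parabolaArcInfty]) (isHomogeneous_contactConic ..) 3).2 ?_
        rw [Polynomial.C_0, sub_zero]
        exact hpar ▸ ⟨_, aeval_parabolaArcInfty_parabola ..⟩
    · exact ⟨⟨.inr ⟨t, hP⟩, hsmooth.pull M _ P.rep_nonzero⟩, _, ⟨x, rfl⟩, hinj.2 hx,
        (three_le_interMult_contactConic_iff hc hP).2 hosc⟩

end Osculation

lemma IsGeneralParam.exists_osculating_conics {δ : ℂ} (hδ : IsGeneralParam δ) :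
    ∃ (r : Fin 5 → ℂ) (x : Fin 5 → Fin 3 → ℂ), Function.Injective r ∧
      (∀ i, IsGeneralOsculating δ (r i) (x i 0) (x i 1) (x i 2)) ∧
      (∀ i c c', c ≠ 0 → c' ≠ 0 → (IsTorusType (parabola c 0 0 * parabola c' 1 δ *
        contactConic (x i 0) (x i 1) (x i 2)) ↔ i = 0)) ∧
      ∀ t, ∀ y : Fin 3 → ℂ, y ≠ 0 → IsOsculating δ t (y 0) (y 1) (y 2) → ∃ i, r i = t := by
  obtain ⟨r, hinj, hr0, hri, hroots⟩ := hδ.exists_flex_params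
  have hosc (i : Fin 5) : ∃ x : Fin 3 → ℂ, IsGeneralOsculating δ (r i) (x 0) (x 1) (x 2) ∧
      ∀ c c', c ≠ 0 → c' ≠ 0 → (IsTorusType (parabola c 0 0 * parabola c' 1 δ *
        contactConic (x 0) (x 1) (x 2)) ↔ i = 0) := by
    obtain rfl | hi := eq_or_ne i 0
    · refine ⟨![_, _, _], isGeneralOsculating_torus hδ hr0, fun c c' hc hc' => ?_⟩
      have hm : 2 * r 0 + 1 ≠ 0 := fun h => hδ.ne_quarter (by linear_combination 2 * hr0 - h)
      have hδr : -r 0 / 2 = δ := by linear_combination -hr0 / 2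
      exact iff_of_true (hδr ▸ isTorusType_conics hc hc' hm) rfl
    · obtain ⟨w, hw, hwr⟩ := hri i hi
      obtain ⟨h0, h1, h2⟩ := hδ.ne_of_cube_root hw hwr
      have hgen := isGeneralOsculating_cube_root hδ hw hwr
      exact ⟨![_, _, _], hgen, fun c c' hc hc' =>
        iff_of_false (hgen.not_isTorusType hc hc' h0 h1 h2) hi⟩
  choose x hx htorus using hosc
  refine ⟨r, x, hinj, hx, htorus, fun t y hy ht => hroots t (ht.flex_equation ?_)⟩
  rintro ⟨h0, h1, h2⟩
  exact hy (funext <| Fin.forall_fin_succ.2 ⟨h0, Fin.forall_fin_two.2 ⟨h1, h2⟩⟩)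

theorem IsGeneralParam.configuration {δ : ℂ} (hδ : IsGeneralParam δ) {M : Frame} {c c' : ℂ}
    (hc : c ≠ 0) (hc' : c' ≠ 0) {p₁ p₂ : Plane} (h₁ : HasCoords M p₁ ![0, 0, 1])
    (h₂ : HasCoords M p₂ (parabolaPoint 0 0 0)) :
    ∃ Φ : Submodule ℂ Form,
      (∀ h, h ∈ Φ ↔ h.IsHomogeneous 2 ∧ 3 ≤ interMult (pull M (parabola c 0 0)) h p₂) ∧
      Module.finrank ℂ Φ = 3 ∧
      ∃ Q : Fin 5 → Plane,
        Function.Injective Q ∧ (∀ i, Q i ≠ p₁) ∧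
        {P | IsConicalFlex Φ (pull M (parabola c' 1 δ)) P} = insert p₁ (Set.range Q) ∧
        ∀ i, ∃ h ∈ Φ, h ≠ 0 ∧ 3 ≤ interMult (pull M (parabola c' 1 δ)) h (Q i) ∧
          (∀ h' ∈ Φ, 3 ≤ interMult (pull M (parabola c' 1 δ)) h' (Q i) → ∃ a : ℂ, h' = a • h) ∧
          IsConic h ∧
          HasSingularities3A5And3A1 (pull M (parabola c 0 0) * pull M (parabola c' 1 δ) * h)
            {p₁, p₂, Q i} ∧
          (IsTorusType (pull M (parabola c 0 0) * pull M (parabola c' 1 δ) * h) ↔ i = 0) := by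
  obtain ⟨r, x, hinj, hx, htorus, hr⟩ := hδ.exists_osculating_conics
  choose Q hQ using fun i => exists_hasCoords_parabolaPoint M 1 δ (r i)
  have hsmooth (i : Fin 5) := isSmooth_contactConic (x i 1) (x i 2) (hx i).A_ne
  refine ⟨_, mem_range_contactFamily_iff hc h₂, finrank_range_contactFamily M, Q, ?_, ?_, ?_,
    fun i => ⟨_, ⟨x i, rfl⟩, ((hsmooth i).pull M).ne_zero, ?_, ?_, ?_, ?_, ?_⟩⟩
  · exact fun i j hij => hinj ((hQ i).abscissa_eq (hij ▸ hQ j))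
  · exact fun i hi => h₁.not_parabolaPoint (hi ▸ hQ i)
  · ext P
    rw [Set.mem_ofPred_eq, isConicalFlex_range_contactFamily_iff hc', h₁.iff_eq]
    refine or_congr_right ⟨?_, ?_⟩
    · rintro ⟨t, hP, y, hy, ht⟩
      obtain ⟨i, rfl⟩ := hr t y hy ht
      exact ⟨i, (hQ i).eq hP⟩
    · rintro ⟨i, rfl⟩
      exact ⟨r i, hQ i, x i, fun h => (hx i).A_ne (congrFun h 0), (hx i).toIsOsculating⟩
  · exact (three_le_interMult_contactConic_iff hc' (hQ i)).2 (hx i).toIsOsculating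
  · rintro _ ⟨y, rfl⟩ h3
    obtain ⟨a, rfl⟩ :=
      (hx i).exists_eq_smul ((three_le_interMult_contactConic_iff hc' (hQ i)).1 h3)
    exact ⟨a, map_smul (contactFamily M) a _⟩
  · exact ((hsmooth i).pull M).isConic (isHomogeneous_pull M (isHomogeneous_contactConic ..))
  · exact (hx i).hasSingularities hc hc' h₁ h₂ (hQ i)
  · rw [contactFamily_apply, ← map_mul, ← map_mul, isTorusType_pull_iff]
    exact htorus i c c' hc hc'

/-! ### The family of pairs -/

/-- The conics touching `y = 1` at `P₁` and `y = -1` at `P₂`, with the equation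
`b x² + a (y² - z²)`. -/
def bitangentConic {R : Type*} [CommRing R] (a b : R) : MvPolynomial (Fin 3) R :=
  quad b 0 0 a 0 (-a)

/-- The conics meeting `bitangentConic a b` at `P₁` with contact of order three, with the equation
`α (b x² + a (y² - z²)) + (y - z) (β x + γ (y - z))`. -/
def partnerConic {R : Type*} [CommRing R] (a b α β γ : R) : MvPolynomial (Fin 3) R :=
  quad (α * b) β (-β) (α * a + γ) (-2 * γ) (-(α * a) + γ)

/-- The frame with the coordinates `s x`, `y - z` and `k (y + z)`, in which `P₁` and `P₂` are
`(0 : 0 : 1)` and `(0 : 1 : 0)`. -/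
def adaptedFrame {s k : ℂ} (hs : s ≠ 0) (hk : k ≠ 0) : Frame :=
  Matrix.GeneralLinearGroup.mkOfDetNeZero !![s, 0, 0; 0, 1, -1; 0, k, k]
    (by simp [Matrix.det_fin_three, hs, hk, ← two_mul])

section AdaptedFrame

variable {s k c : ℂ} (hs : s ≠ 0) (hk : k ≠ 0)

lemma act_adaptedFrame (v : Fin 3 → ℂ) :
    act (adaptedFrame hs hk) v = ![s * v 0, v 1 - v 2, k * (v 1 + v 2)] := by
  ext i
  fin_cases i <;>
    simp [act_apply, adaptedFrame, Matrix.GeneralLinearGroup.mkOfDetNeZero, Fin.sum_univ_three] <;>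
    ring

lemma hasCoords_adaptedFrame_P₁ : HasCoords (adaptedFrame hs hk) P₁ ![0, 0, 1] := by
  refine hasCoords_mk _ (b := 2 * k) ?_
  rw [act_adaptedFrame]
  ext i
  fin_cases i <;> simp
  ring

lemma hasCoords_adaptedFrame_P₂ :
    HasCoords (adaptedFrame hs hk) P₂ (parabolaPoint 0 0 0) := by
  refine hasCoords_mk _ (b := -2) ?_
  rw [act_adaptedFrame]
  ext i
  fin_cases i <;> simp [parabolaPoint]
  ring

lemma pull_adaptedFrame_parabola :
    pull (adaptedFrame hs hk) (parabola c 0 0) = bitangentConic (-(c * k)) (c * s ^ 2) := by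
  refine MvPolynomial.funext fun v => ?_
  rw [eval_pull, act_adaptedFrame, eval_parabola, bitangentConic, eval_quad]
  simp only [Matrix.cons_val]
  ring

lemma pull_adaptedFrame_quad {a b α β γ x y : ℂ} (hx : α * b = x * s ^ 2)
    (hxk : α * a = -(x * k)) (hy : β = s * y) :
    pull (adaptedFrame hs hk) (quad x y 0 γ (-x) 0) = partnerConic a b α β γ := by
  refine MvPolynomial.funext fun v => ?_
  rw [eval_pull, act_adaptedFrame, eval_quad, partnerConic, eval_quad, hx, hxk, hy]
  simp only [Matrix.cons_val]
  ring

end AdaptedFrame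

section Pairs

variable {a b c d e k α β : ℂ}

lemma interMult_comm (F G : Form) (P : Plane) : interMult F G P = interMult G F P := by
  rw [interMult, interMult, Set.pair_comm]

lemma two_le_interMult_quad_iff {σ : ℂ} {L : Form} (hL : L.IsHomogeneous 1) (hLs : IsSmooth L)
    (hL0 : aeval ![Polynomial.X, Polynomial.C σ, 1] L = 0) {P : Plane}
    (hP : HasCoords 1 P ![0, σ, 1]) :
    2 ≤ interMult (quad a b c d e k) L P ↔ d * σ ^ 2 + e * σ + k = 0 ∧ b * σ + c = 0 := by
  have harcEval : arcEval ![Polynomial.X, Polynomial.C σ, 1] 0 = ![0, σ, 1] := by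
    ext i
    fin_cases i <;> simp [arcEval]
  have harc : IsArc ![Polynomial.X, Polynomial.C σ, 1] 0 L :=
    ⟨fun κ h => by simpa [arcEval] using congrFun h 0, hL0⟩
  have hdvd := harc.le_interMult_pull_iff hL hLs (harcEval ▸ hP) (isHomogeneous_quad a b c d e k) 2
  have haeval : aeval ![Polynomial.X, Polynomial.C σ, 1] (quad a b c d e k) =
      Polynomial.C (d * σ ^ 2 + e * σ + k) + Polynomial.C (b * σ + c) * Polynomial.X +
        Polynomial.X ^ 2 * Polynomial.C a := by
    simp only [aeval_quad, Polynomial.algebraMap_eq, Matrix.cons_val, map_add, map_mul, map_pow]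
    ring
  rw [pull_one, pull_one, interMult_comm, Polynomial.C_0, sub_zero, haeval,
    dvd_add_left (dvd_mul_right _ _), Polynomial.X_pow_dvd_iff] at hdvd
  refine hdvd.trans ⟨fun h => ?_, fun h d hd => ?_⟩
  · simpa [-map_add, -map_mul, Polynomial.coeff_X, Polynomial.coeff_C] using
      And.intro (h 0 two_pos) (h 1 one_lt_two)
  · interval_cases d <;> simp [-map_add, -map_mul, h.1, h.2]

lemma two_le_interMult_line₁_iff :
    2 ≤ interMult (quad a b c d e k) (X 1 - X 2) P₁ ↔ d + e + k = 0 ∧ b + c = 0 := by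
  have hP₁ : HasCoords 1 P₁ ![0, 1, 1] := hasCoords_mk _ (b := 1) (by simp [act_one])
  rw [two_le_interMult_quad_iff ((isHomogeneous_X ℂ 1).sub (isHomogeneous_X ℂ 2))
    (fun v _ => ⟨1, by simp [pderiv_X]⟩) (by simp) hP₁]
  simp

lemma two_le_interMult_line₂_iff :
    2 ≤ interMult (quad a b c d e k) (X 1 + X 2) P₂ ↔ d - e + k = 0 ∧ c - b = 0 := by
  have hP₂ : HasCoords 1 P₂ ![0, -1, 1] := hasCoords_mk _ (b := 1) (by simp [act_one])
  rw [two_le_interMult_quad_iff ((isHomogeneous_X ℂ 1).add (isHomogeneous_X ℂ 2))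
    (fun v _ => ⟨1, by simp [pderiv_X]⟩) (by simp) hP₂]
  ring_nf

lemma IsConic.ne_mul {F G H : Form} (hF : IsConic F) (hG : G.IsHomogeneous 1)
    (hH : H.IsHomogeneous 1) : F ≠ G * H := by
  have not_isUnit {L : Form} (hL : L.IsHomogeneous 1) : ¬ IsUnit L := by
    intro hu
    obtain ⟨c, hc, rfl⟩ := MvPolynomial.isUnit_iff_eq_C_of_isReduced.1 hu
    exact zero_ne_one ((isHomogeneous_C (Fin 3) c).inj_right hL (by simpa using hc.ne_zero))
  exact fun h => (hF.2.isUnit_or_isUnit h).elim (not_isUnit hG) (not_isUnit hH)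

lemma IsConic.exists_eq_bitangentConic {F : Form} (hF : IsConic F)
    (h₁ : 2 ≤ interMult F (X 1 - X 2) P₁) (h₂ : 2 ≤ interMult F (X 1 + X 2) P₂) :
    ∃ a b : ℂ, a ≠ 0 ∧ b ≠ 0 ∧ F = bitangentConic a b := by
  have hX (i : Fin 3) : (X i : Form).IsHomogeneous 1 := isHomogeneous_X ℂ i
  obtain ⟨b, m, n, a, e, k, rfl⟩ := exists_eq_quad hF.1
  rw [two_le_interMult_line₁_iff] at h₁
  rw [two_le_interMult_line₂_iff] at h₂
  obtain rfl : e = 0 := by linear_combination (h₁.1 - h₂.1) / 2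
  obtain rfl : k = -a := by linear_combination h₁.1
  obtain rfl : m = 0 := by linear_combination (h₁.2 - h₂.2) / 2
  obtain rfl : n = 0 := by linear_combination h₁.2
  refine ⟨a, b, ?_, ?_, rfl⟩
  · rintro rfl
    refine hF.ne_mul ((hX 0).C_mul b) (hX 0) ?_
    simp [quad]
    ring
  · rintro rfl
    refine hF.ne_mul (((hX 1).sub (hX 2)).C_mul a) ((hX 1).add (hX 2)) ?_
    simp [quad]
    ring

lemma interMult_pull_parabola_eq_three_iff {M : Frame} {P : Plane} {F : Form}
    (hF : F.IsHomogeneous 2) (hc : c ≠ 0) (hP : HasCoords M P ![0, 0, 1]) :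
    interMult (pull M (parabola c 0 0)) (pull M F) P = 3 ↔
      ∃ x y z, y ≠ 0 ∧ F = quad x y 0 z (-x) 0 := by
  have haeval (x y u z e k : ℂ) : aeval (parabolaArcInfty 0 0) (quad x y u z e k) =
      Polynomial.C k + Polynomial.C u * Polynomial.X +
        Polynomial.C (x + e) * Polynomial.X ^ 2 +
        Polynomial.X ^ 3 * (Polynomial.C y + Polynomial.C z * Polynomial.X) := by
    simp only [aeval_quad, parabolaArcInfty, Polynomial.algebraMap_eq, Matrix.cons_val, map_add,
      map_zero]
    ring
  rw [(isArc_parabolaArcInfty c 0 0).interMult_pull isHomogeneous_parabola (isSmooth_parabola hc)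
    (by rwa [arcEval_parabolaArcInfty]) hF]
  constructor
  · intro h
    obtain ⟨x, y, u, z, e, k, rfl⟩ := exists_eq_quad hF
    obtain ⟨h3, h4⟩ := (emultiplicity_eq_coe (n := 3)).1 h
    rw [Polynomial.C_0, sub_zero, haeval] at h3 h4
    rw [dvd_add_left (dvd_mul_right _ _), Polynomial.X_pow_dvd_iff] at h3
    obtain rfl : k = 0 := by simpa using h3 0
    obtain rfl : u = 0 := by simpa [-map_add, Polynomial.coeff_X, Polynomial.coeff_C] using h3 1
    obtain rfl : e = -x := by
      rw [eq_neg_iff_add_eq_zero, add_comm]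
      simpa [-map_add] using h3 2
    refine ⟨x, y, z, ?_, rfl⟩
    rintro rfl
    exact h4 ⟨Polynomial.C z, by simp; ring⟩
  · rintro ⟨x, y, z, hy, rfl⟩
    have hq : (Polynomial.C y + Polynomial.C z * Polynomial.X).eval 0 ≠ 0 := by simpa
    rw [haeval]
    simpa using emultiplicity_X_sub_C_pow_mul hq 3

lemma IsConic.exists_eq_partnerConic {F : Form} (hF : IsConic F) (ha : a ≠ 0) (hb : b ≠ 0)
    (h : interMult (bitangentConic a b) F P₁ = 3) :
    ∃ α β γ : ℂ, α ≠ 0 ∧ β ≠ 0 ∧ F = partnerConic a b α β γ := by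
  have hX (i : Fin 3) : (X i : Form).IsHomogeneous 1 := isHomogeneous_X ℂ i
  have hk : -(a / b) ≠ 0 := neg_ne_zero.2 (div_ne_zero ha hb)
  let M := adaptedFrame one_ne_zero hk
  have hparabola : pull M (parabola b 0 0) = bitangentConic a b := by
    rw [pull_adaptedFrame_parabola]
    congr 1 <;> field_simp
  have hpull : pull M (pull M⁻¹ F) = F := by simpa using pull_inv_pull M⁻¹ F
  rw [← hparabola, ← hpull, interMult_pull_parabola_eq_three_iff (isHomogeneous_pull _ hF.1) hb
    (hasCoords_adaptedFrame_P₁ _ _)] at h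
  obtain ⟨x, y, z, hy, hxyz⟩ := h
  have hFeq : F = partnerConic a b (x / b) y z := by
    rw [← hpull, hxyz]
    exact pull_adaptedFrame_quad _ _ (by field_simp) (by field_simp) (one_mul y).symm
  refine ⟨x / b, y, z, ?_, hy, hFeq⟩
  intro hx
  refine hF.ne_mul (((hX 0).C_mul y).add (((hX 1).sub (hX 2)).C_mul z)) ((hX 1).sub (hX 2)) ?_
  rw [hFeq, hx]
  refine MvPolynomial.funext fun v => ?_
  simp only [partnerConic, eval_quad, map_add, map_sub, map_mul, eval_C, eval_X]
  ring

lemma IsConicPair.exists_eq {f g : Form} (h : IsConicPair f g) :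
    ∃ a b α β γ : ℂ, a ≠ 0 ∧ b ≠ 0 ∧ α ≠ 0 ∧ β ≠ 0 ∧ f = bitangentConic a b ∧
      g = partnerConic a b α β γ := by
  obtain ⟨a, b, ha, hb, rfl⟩ := h.conic_f.exists_eq_bitangentConic h.tangent₁ h.tangent₂
  obtain ⟨α, β, γ, hα, hβ, rfl⟩ := h.conic_g.exists_eq_partnerConic ha hb h.contact
  exact ⟨a, b, α, β, γ, ha, hb, hα, hβ, rfl, rfl⟩

-- The scale `s = α b / β` makes the coefficient of `u` in the second parabola equal to `1`.
lemma exists_normal_form (γ : ℂ) (ha : a ≠ 0) (hb : b ≠ 0) (hα : α ≠ 0) (hβ : β ≠ 0) :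
    ∃ (M : Frame) (c c' : ℂ), HasCoords M P₁ ![0, 0, 1] ∧ HasCoords M P₂ (parabolaPoint 0 0 0) ∧
      c ≠ 0 ∧ c' ≠ 0 ∧ pull M (parabola c 0 0) = bitangentConic a b ∧
      pull M (parabola c' 1 (γ * α * b / β ^ 2)) = partnerConic a b α β γ := by
  have hs : α * b / β ≠ 0 := by simp [hα, hb, hβ]
  have hk : -(a * α ^ 2 * b / β ^ 2) ≠ 0 := by simp [ha, hα, hb, hβ]
  refine ⟨adaptedFrame hs hk, β ^ 2 / (α ^ 2 * b), β ^ 2 / (α * b), hasCoords_adaptedFrame_P₁ hs hk,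
    hasCoords_adaptedFrame_P₂ hs hk, by simp [hα, hb, hβ], by simp [hα, hb, hβ], ?_, ?_⟩
  · rw [pull_adaptedFrame_parabola]
    congr 1 <;> field_simp
  · have hγ : β ^ 2 / (α * b) * (γ * α * b / β ^ 2) = γ := by field_simp
    rw [parabola, hγ]
    apply pull_adaptedFrame_quad <;> field_simp

lemma isConicPair_partnerConic (γ : ℂ) (ha : a ≠ 0) (hb : b ≠ 0) (hα : α ≠ 0) (hβ : β ≠ 0) :
    IsConicPair (bitangentConic a b) (partnerConic a b α β γ) := by
  obtain ⟨M, c, c', hP₁, -, hc, hc', hF, hG⟩ := exists_normal_form γ ha hb hα hβ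
  have isConic_pull {c ε δ : ℂ} (hc : c ≠ 0) : IsConic (pull M (parabola c ε δ)) :=
    ((isSmooth_parabola hc).pull M).isConic (isHomogeneous_pull M isHomogeneous_parabola)
  refine ⟨hF ▸ isConic_pull hc, hG ▸ isConic_pull hc', ?_, ?_, ?_⟩
  · simp [bitangentConic, two_le_interMult_line₁_iff]
  · simp [bitangentConic, two_le_interMult_line₂_iff]
  · rw [← hF, ← hG, interMult_pull_parabola_eq_three_iff isHomogeneous_parabola hc hP₁]
    exact ⟨c', c' * 1, _, by simpa using hc', rfl⟩

end Pairs

/-! ### Generic pairs -/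

/-- Polynomials in the coefficients of two forms. -/
abbrev CoeffPoly := MvPolynomial ((Fin 3 →₀ ℕ) ⊕ (Fin 3 →₀ ℕ)) ℂ

section CoeffQuad

variable {R : Type*} [CommRing R] (a b c d e k : R)

lemma coeff_quad_xx : coeff (Finsupp.single 0 2) (quad a b c d e k) = a := by
  simp [quad, X, monomial_mul, monomial_pow, coeff_C_mul, coeff_monomial, Finsupp.ext_iff,
    Fin.forall_fin_succ, Finsupp.single_apply]

lemma coeff_quad_xy :
    coeff (Finsupp.single 0 1 + Finsupp.single 1 1) (quad a b c d e k) = b := by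
  simp [quad, X, monomial_mul, monomial_pow, coeff_C_mul, coeff_monomial, Finsupp.ext_iff,
    Fin.forall_fin_succ, Finsupp.single_apply]

lemma coeff_quad_yz :
    coeff (Finsupp.single 1 1 + Finsupp.single 2 1) (quad a b c d e k) = e := by
  simp [quad, X, monomial_mul, monomial_pow, coeff_C_mul, coeff_monomial, Finsupp.ext_iff,
    Fin.forall_fin_succ, Finsupp.single_apply]

lemma map_quad {S : Type*} [CommRing S] (φ : R →+* S) :
    map φ (quad a b c d e k) = quad (φ a) (φ b) (φ c) (φ d) (φ e) (φ k) := by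
  simp [quad]

end CoeffQuad

/-- The product of the polynomials excluded by `IsGeneralParam`, homogenised so that it decides
whether `n / m` is general without a division. -/
def excluded {R : Type*} [CommRing R] (n m : R) : R :=
  n * (4 * n - m) * (6 * n - m) * (3 * n - m) * (48 * n ^ 2 - 12 * n * m + m ^ 2) *
    (16 * n ^ 2 - 4 * n * m + m ^ 2) * (3 * n ^ 2 - 3 * n * m + m ^ 2) *
    (27 * n ^ 2 - 9 * n * m + m ^ 2)

lemma isGeneralParam_div {n m : ℂ} (hm : m ≠ 0) (h : excluded n m ≠ 0) :
    IsGeneralParam (n / m) := by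
  obtain ⟨δ, rfl⟩ : ∃ δ, n = δ * m := ⟨n / m, (div_mul_cancel₀ n hm).symm⟩
  have hmul : excluded (δ * m) m = m ^ 12 * excluded δ 1 := by
    simp only [excluded]
    ring
  rw [hmul] at h
  have h1 := right_ne_zero_of_mul h
  simp only [excluded, mul_ne_zero_iff, mul_one, one_pow] at h1
  rw [mul_div_cancel_right₀ δ hm]
  obtain ⟨⟨⟨⟨⟨⟨⟨h0, h4⟩, h6⟩, h3⟩, h48⟩, h16⟩, h33⟩, h27⟩ := h1
  exact ⟨h0, h4, h6, h3, h48, h16, h33, h27⟩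

/-- The polynomial in the coefficients of a pair of conics whose non-vanishing makes the pair
general. On `partnerConic a b α β γ` the coefficients of `x²`, `x y` and `y z` are `α b`, `β` and
`-2 γ`, and the parameter of the pair is `γ α b / β²`. -/
def discr : CoeffPoly :=
  excluded (C (-1 / 2) * X (Sum.inr (Finsupp.single 1 1 + Finsupp.single 2 1)) *
    X (Sum.inr (Finsupp.single 0 2)))
    (X (Sum.inr (Finsupp.single 0 1 + Finsupp.single 1 1)) ^ 2)

lemma evalCoeffs_discr (f : Form) (a b α β γ : ℂ) :
    evalCoeffs discr f (partnerConic a b α β γ) = excluded (γ * α * b) (β ^ 2) := by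
  have hγ : -1 / 2 * (-2 * γ) * (α * b) = γ * α * b := by ring
  rw [← hγ]
  simp [evalCoeffs, discr, excluded, partnerConic, coeff_quad_xx, coeff_quad_xy, coeff_quad_yz]

lemma exists_isConicPair_evalCoeffs_discr_ne_zero :
    ∃ f g, IsConicPair f g ∧ evalCoeffs discr f g ≠ 0 := by
  refine ⟨_, _, isConicPair_partnerConic 1 one_ne_zero one_ne_zero one_ne_zero one_ne_zero, ?_⟩
  rw [evalCoeffs_discr, excluded]
  norm_num

/-- The pullback of a polynomial in the coefficients of a pair of conics to the space of the
parameters `(a, b, α, β, γ)` of the family. -/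
def paramPoly (E : CoeffPoly) : MvPolynomial (Fin 5) ℂ :=
  aeval (Sum.elim (fun m => coeff m (bitangentConic (X 0) (X 1)))
    fun m => coeff m (partnerConic (X 0) (X 1) (X 2) (X 3) (X 4))) E

lemma eval_paramPoly (p : Fin 5 → ℂ) (E : CoeffPoly) :
    eval p (paramPoly E) =
      evalCoeffs E (bitangentConic (p 0) (p 1)) (partnerConic (p 0) (p 1) (p 2) (p 3) (p 4)) := by
  have hf : map (eval p) (bitangentConic (X 0) (X 1)) = bitangentConic (p 0) (p 1) := by
    simp [bitangentConic, map_quad]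
  have hg : map (eval p) (partnerConic (X 0) (X 1) (X 2) (X 3) (X 4)) =
      partnerConic (p 0) (p 1) (p 2) (p 3) (p 4) := by
    simp [partnerConic, map_quad]
  have hC : (eval p).comp (algebraMap ℂ (MvPolynomial (Fin 5) ℂ)) = RingHom.id ℂ := by
    ext x
    simp [algebraMap_eq]
  rw [paramPoly, evalCoeffs, ← hf, ← hg, map_aeval, hC]
  refine congrArg (fun x => eval x E) ?_
  ext (m | m) <;> simp [coeff_map]

-- The family is the image of a dense open subset of the affine space of parameters, which is
-- irreducible: there a product vanishes only if one of its factors does.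
lemma evalCoeffs_eq_zero_of_generic {D E : CoeffPoly}
    (hD : ∃ f g, IsConicPair f g ∧ evalCoeffs D f g ≠ 0)
    (hE : ∀ f g, IsConicPair f g → evalCoeffs D f g ≠ 0 → evalCoeffs E f g = 0)
    {f g : Form} (h : IsConicPair f g) : evalCoeffs E f g = 0 := by
  have evalCoeffs_eq (E : CoeffPoly) {a b α β γ : ℂ} :
      evalCoeffs E (bitangentConic a b) (partnerConic a b α β γ) =
        eval ![a, b, α, β, γ] (paramPoly E) := by
    rw [eval_paramPoly]; rfl
  have hprod : paramPoly E * (paramPoly D * (X 0 * X 1 * X 2 * X 3)) = 0 := by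
    refine MvPolynomial.funext fun p => ?_
    rw [map_mul, map_mul, map_zero, mul_eq_zero, or_iff_not_imp_right, eval_paramPoly,
      eval_paramPoly]
    intro hp
    simp only [map_mul, eval_X, mul_eq_zero, not_or] at hp
    obtain ⟨hDp, ⟨⟨ha, hb⟩, hα⟩, hβ⟩ := hp
    exact hE _ _ (isConicPair_partnerConic _ ha hb hα hβ) hDp
  have hD0 : paramPoly D ≠ 0 := by
    obtain ⟨f, g, hfg, hne⟩ := hD
    obtain ⟨a, b, α, β, γ, -, -, -, -, rfl, rfl⟩ := hfg.exists_eq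
    rintro h0
    exact hne (by rw [evalCoeffs_eq, h0, map_zero])
  have hE0 : paramPoly E = 0 := by
    simpa [hD0, X_ne_zero] using hprod
  obtain ⟨a, b, α, β, γ, -, -, -, -, rfl, rfl⟩ := h.exists_eq
  rw [evalCoeffs_eq, hE0, map_zero]

end ThreeConics

end

theorem mainTheorem8 :
    ThreeConics.HoldsGenerically ThreeConics.IsConicPair fun f g =>
      ∃ Φ : Submodule ℂ ThreeConics.Form,
        (∀ h, h ∈ Φ ↔ h.IsHomogeneous 2 ∧ 3 ≤ ThreeConics.interMult f h ThreeConics.P₂) ∧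
        Module.finrank ℂ Φ = 3 ∧
        ∃ Q : Fin 5 → ThreeConics.Plane,
          Function.Injective Q ∧ (∀ i, Q i ≠ ThreeConics.P₁) ∧
          {P | ThreeConics.IsConicalFlex Φ g P} = insert ThreeConics.P₁ (Set.range Q) ∧
          ∀ i, ∃ h ∈ Φ, h ≠ 0 ∧ 3 ≤ ThreeConics.interMult g h (Q i) ∧
            (∀ h' ∈ Φ, 3 ≤ ThreeConics.interMult g h' (Q i) → ∃ c : ℂ, h' = c • h) ∧
            ThreeConics.IsConic h ∧
            ThreeConics.HasSingularities3A5And3A1 (f * g * h)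
              {ThreeConics.P₁, ThreeConics.P₂, Q i} ∧
            (ThreeConics.IsTorusType (f * g * h) ↔ i = 0) := by
  have hne := ThreeConics.exists_isConicPair_evalCoeffs_discr_ne_zero
  refine ⟨ThreeConics.discr, hne,
    fun E hE f g h => ThreeConics.evalCoeffs_eq_zero_of_generic hne hE h, fun f g h hD => ?_⟩
  obtain ⟨a, b, α, β, γ, ha, hb, hα, hβ, rfl, rfl⟩ := h.exists_eq
  obtain ⟨M, c, c', h₁, h₂, hc, hc', hF, hG⟩ := ThreeConics.exists_normal_form γ ha hb hα hβ
  rw [ThreeConics.evalCoeffs_discr] at hD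
  rw [← hF, ← hG]
  exact (ThreeConics.isGeneralParam_div (pow_ne_zero 2 hβ) hD).configuration hc hc' h₁ h₂
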